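/- A vector lattice is a real vector lattice, and Dedekind complete means that every non-empty subset that is bounded above has a supremum (so that the vector lattice is Archimedean). For a vector lattice $V$, a net $(x_\alpha)_{\alpha\in A}$ in $V$ is order convergent to $x\in V$ when there is a net $(y_\beta)_{\beta\in B}$ in $V$, decreasing with infimum $0$, such that for every $\beta_0\in B$ there is an $\alpha_0\in A$ with $|x-x_\alpha|\le y_{\beta_0}$ for all $\alpha\ge\alpha_0$. It is unbounded order convergent to $x$ when $|x_\alpha-x|\wedge y$ is order convergent to $0$ for every $y\ge 0$ in $V$. A locally solid linear topology on $V$ is a topology that makes $V$ a (not necessarily Hausdorff) topological vector space in which $0$ has a base of neighbourhoods consisting of solid sets. It is an o-Lebesgue topology when every net in $V$ that is order convergent to $0$ converges to $0$ in the topology, and a uo-Lebesgue topology when every net in $V$ that is unbounded order convergent to $0$ converges to $0$ in the topology. An orthomorphism on $V$ is an order bounded linear operator on $V$ that maps every band of $V$ into itself. When $V$ is Dedekind complete, the orthomorphisms on $V$ form a vector lattice $\operatorname{Orth}(V)$ under the order given by $S\le T$ if and only if $Sx\le Tx$ for all $x\ge 0$. **Theorem.** Let $E$ be a Dedekind complete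 vector lattice. The following are equivalent: 1. $E$ admits a Hausdorff o-Lebesgue topology; 2. $\operatorname{Orth}(E)$ admits a Hausdorff o-Lebesgue topology; 3. $E$ admits a Hausdorff uo-Lebesgue topology; 4. $\operatorname{Orth}(E)$ admits a Hausdorff uo-Lebesgue topology. Moreover, a Hausdorff uo-Lebesgue topology on $E$, respectively on $\operatorname{Orth}(E)$, is unique whenever it exists. -/

import Mathlib

open Set Filter Topology

universe u

/-! ### Convergence of nets in vector lattices -/

section Convergence

variable {V : Type u} [AddCommGroup V] [Lattice V] [IsOrderedAddMonoid V]
  [Module ℝ V] [IsOrderedModule ℝ V]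

/-- The net `x` is order convergent to `a`: there is a net `y` (with its own index set), decreasing
with infimum `0`, such that for every index `β₀` eventually `|a - x α| ≤ y β₀`.
Index sets in the universe of `V` suffice, as only the tails of the net matter. -/
def OrderTendsto {ι : Type u} [Preorder ι] (x : ι → V) (a : V) : Prop :=
  ∃ (κ : Type u) (_ : Preorder κ) (_ : IsDirectedOrder κ) (_ : Nonempty κ) (y : κ → V),
    Antitone y ∧ IsGLB (range y) 0 ∧
      ∀ β₀ : κ, ∃ α₀ : ι, ∀ α : ι, α₀ ≤ α → |a - x α| ≤ y β₀

/-- The net `x` is unbounded order convergent to `a`. -/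
def UnboundedOrderTendsto {ι : Type u} [Preorder ι] (x : ι → V) (a : V) : Prop :=
  ∀ y : V, 0 ≤ y → OrderTendsto (fun α => |x α - a| ⊓ y) 0

/-- A (not necessarily Hausdorff) locally solid linear topology: a vector space topology with
a base of neighbourhoods of `0` that consists of solid sets. -/
structure IsLocallySolidLinear (τ : TopologicalSpace V) : Prop where
  isTopologicalAddGroup : @IsTopologicalAddGroup V τ _
  continuousSMul : @ContinuousSMul ℝ V _ _ τ
  hasBasis_solid : (@nhds V τ 0).HasBasis
    (fun s : Set V => s ∈ @nhds V τ 0 ∧ LatticeOrderedAddCommGroup.IsSolid s) id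

/-- An o-Lebesgue topology: locally solid linear, and order convergence to `0` of a net implies
its topological convergence to `0`. -/
structure IsOLebesgue (τ : TopologicalSpace V) : Prop extends IsLocallySolidLinear τ where
  tendsto_of_orderTendsto : ∀ (ι : Type u) [Preorder ι] [IsDirectedOrder ι] [Nonempty ι]
    (x : ι → V), OrderTendsto x 0 → Tendsto x atTop (@nhds V τ 0)

/-- A uo-Lebesgue topology: locally solid linear, and unbounded order convergence to `0` of a net
implies its topological convergence to `0`. -/
structure IsUoLebesgue (τ : TopologicalSpace V) : Prop extends IsLocallySolidLinear τ where
  tendsto_of_unboundedOrderTendsto :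
    ∀ (ι : Type u) [Preorder ι] [IsDirectedOrder ι] [Nonempty ι]
      (x : ι → V), UnboundedOrderTendsto x 0 → Tendsto x atTop (@nhds V τ 0)

end Convergence

/-! ### Orthomorphisms -/

section Orthomorphisms

section General

variable {E : Type u} [AddCommGroup E] [Lattice E] [IsOrderedAddMonoid E]
  [Module ℝ E] [IsOrderedModule ℝ E]

/-- A band: a solid linear subspace (i.e. an ideal) that contains all suprema, as far as they exist
in `E`, of its nonempty subsets. -/
def IsBand (B : Submodule ℝ E) : Prop :=
  LatticeOrderedAddCommGroup.IsSolid (B : Set E) ∧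
    ∀ S : Set E, S ⊆ B → S.Nonempty → ∀ x : E, IsLUB S x → x ∈ B

/-- `T` maps order intervals into order intervals. -/
def IsOrderBoundedMap (T : E →ₗ[ℝ] E) : Prop :=
  ∀ a b : E, ∃ c d : E, ∀ x ∈ Icc a b, T x ∈ Icc c d

/-- `T` leaves all bands invariant. -/
def IsBandPreserving (T : E →ₗ[ℝ] E) : Prop :=
  ∀ B : Submodule ℝ E, IsBand B → ∀ x ∈ B, T x ∈ B

variable (E) in
/-- The vector space `Orth(E)` of orthomorphisms: the order bounded band preserving operators. -/
def Orth : Submodule ℝ (E →ₗ[ℝ] E) where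
  carrier := {T | IsOrderBoundedMap T ∧ IsBandPreserving T}
  add_mem' := by
    rintro S T ⟨hS, hS'⟩ ⟨hT, hT'⟩
    refine ⟨fun a b => ?_, fun B hB x hx => B.add_mem (hS' B hB x hx) (hT' B hB x hx)⟩
    obtain ⟨c, d, h⟩ := hS a b
    obtain ⟨c', d', h'⟩ := hT a b
    exact ⟨c + c', d + d', fun x hx =>
      ⟨add_le_add (h x hx).1 (h' x hx).1, add_le_add (h x hx).2 (h' x hx).2⟩⟩
  zero_mem' := ⟨fun _ _ => ⟨0, 0, fun _ _ => by simp⟩, fun B _ _ _ => B.zero_mem⟩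
  smul_mem' := by
    rintro r T ⟨hT, hT'⟩
    refine ⟨fun a b => ?_, fun B hB x hx => B.smul_mem r (hT' B hB x hx)⟩
    obtain ⟨c, d, h⟩ := hT a b
    rcases le_total 0 r with hr | hr
    · exact ⟨r • c, r • d, fun x hx =>
        ⟨smul_le_smul_of_nonneg_left (h x hx).1 hr, smul_le_smul_of_nonneg_left (h x hx).2 hr⟩⟩
    · exact ⟨r • d, r • c, fun x hx =>
        ⟨smul_le_smul_of_nonpos_left (h x hx).2 hr, smul_le_smul_of_nonpos_left (h x hx).1 hr⟩⟩

/-- Orthomorphisms carry the usual order of operators: `S ≤ T` when `S x ≤ T x` for all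
`x ≥ 0`. -/
instance Orth.instPartialOrder : PartialOrder (Orth E) where
  le S T := ∀ x : E, 0 ≤ x → S.1 x ≤ T.1 x
  le_refl _ _ _ := le_rfl
  le_trans _ _ _ h h' x hx := (h x hx).trans (h' x hx)
  le_antisymm S T h h' := by
    apply Subtype.ext
    ext x
    have key : ∀ y : E, 0 ≤ y → S.1 y = T.1 y := fun y hy => le_antisymm (h y hy) (h' y hy)
    rw [← posPart_sub_negPart x, map_sub, map_sub, key _ (posPart_nonneg x),
      key _ (negPart_nonneg x)]

theorem Orth.le_def (S T : Orth E) : S ≤ T ↔ ∀ x : E, 0 ≤ x → S.1 x ≤ T.1 x := Iff.rfl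

instance Orth.instIsOrderedAddMonoid : IsOrderedAddMonoid (Orth E) where
  add_le_add_left _ _ h U x hx := add_le_add_left (h x hx) (U.1 x)

instance Orth.instIsOrderedModule : IsOrderedModule ℝ (Orth E) where
  smul_le_smul_of_nonneg_left r hr _ _ h x hx :=
    smul_le_smul_of_nonneg_left (h x hx) hr
  smul_le_smul_of_nonneg_right S hS r s h x hx :=
    smul_le_smul_of_nonneg_right h (show 0 ≤ S.1 x from hS x hx)

end General

/-! In the Dedekind complete case, `Orth(E)` is a vector lattice. -/

section Complete

variable {E : Type u} [AddCommGroup E] [ConditionallyCompleteLattice E] [IsOrderedAddMonoid E]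
  [Module ℝ E] [IsOrderedModule ℝ E]

namespace Orth

/-- The Riesz–Kantorovich formula for the positive part of `T` at `x ≥ 0`. -/
noncomputable def posAux (T : E →ₗ[ℝ] E) (x : E) : E := sSup (T '' Icc 0 x)

theorem isLUB_posAux {T : E →ₗ[ℝ] E} (hT : IsOrderBoundedMap T) {x : E} (hx : 0 ≤ x) :
    IsLUB (T '' Icc 0 x) (posAux T x) := by
  refine isLUB_csSup ⟨_, mem_image_of_mem T ⟨le_rfl, hx⟩⟩ ?_
  obtain ⟨c, d, h⟩ := hT 0 x
  exact ⟨d, by rintro _ ⟨y, hy, rfl⟩; exact (h y hy).2⟩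

theorem posAux_add {T : E →ₗ[ℝ] E} (hT : IsOrderBoundedMap T) {x y : E}
    (hx : 0 ≤ x) (hy : 0 ≤ y) : posAux T (x + y) = posAux T x + posAux T y := by
  refine (isLUB_posAux hT (add_nonneg hx hy)).unique ⟨?_, ?_⟩
  · rintro _ ⟨z, hz, rfl⟩
    have h1 : z ⊓ x ∈ Icc 0 x := ⟨le_inf hz.1 hx, inf_le_right⟩
    have h2 : z - z ⊓ x ∈ Icc 0 y := by
      refine ⟨sub_nonneg.2 inf_le_left, ?_⟩
      rw [sub_le_comm]
      exact le_inf (sub_le_self z hy) (sub_le_iff_le_add.2 hz.2)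
    have := add_le_add ((isLUB_posAux hT hx).1 (mem_image_of_mem T h1))
      ((isLUB_posAux hT hy).1 (mem_image_of_mem T h2))
    rwa [← map_add, add_sub_cancel] at this
  · intro c hc
    rw [← le_sub_iff_add_le]
    refine (isLUB_posAux hT hx).2 ?_
    rintro _ ⟨a, ha, rfl⟩
    rw [le_sub_comm]
    refine (isLUB_posAux hT hy).2 ?_
    rintro _ ⟨b, hb, rfl⟩
    rw [le_sub_iff_add_le', ← map_add]
    exact hc (mem_image_of_mem T ⟨add_nonneg ha.1 hb.1, add_le_add ha.2 hb.2⟩)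

theorem posAux_smul_le {T : E →ₗ[ℝ] E} (hT : IsOrderBoundedMap T) {r : ℝ} (hr : 0 < r) {x : E}
    (hx : 0 ≤ x) : posAux T (r • x) ≤ r • posAux T x := by
  refine (isLUB_posAux hT (smul_nonneg hr.le hx)).2 ?_
  rintro _ ⟨y, hy, rfl⟩
  have h1 : r⁻¹ • y ∈ Icc 0 x :=
    ⟨smul_nonneg (inv_nonneg.2 hr.le) hy.1, (inv_smul_le_iff_of_pos hr).2 hy.2⟩
  have := smul_le_smul_of_nonneg_left ((isLUB_posAux hT hx).1 (mem_image_of_mem T h1)) hr.le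
  rwa [map_smul, smul_inv_smul₀ hr.ne'] at this

theorem posAux_smul {T : E →ₗ[ℝ] E} (hT : IsOrderBoundedMap T) {r : ℝ} (hr : 0 < r) {x : E}
    (hx : 0 ≤ x) : posAux T (r • x) = r • posAux T x := by
  refine le_antisymm (posAux_smul_le hT hr hx) ?_
  have := posAux_smul_le hT (inv_pos.2 hr) (smul_nonneg hr.le hx)
  rw [inv_smul_smul₀ hr.ne'] at this
  exact (le_inv_smul_iff_of_pos hr).1 this

theorem posAux_sub {T : E →ₗ[ℝ] E} (hT : IsOrderBoundedMap T) {a b c d : E}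
    (ha : 0 ≤ a) (hb : 0 ≤ b) (hc : 0 ≤ c) (hd : 0 ≤ d) (h : a - b = c - d) :
    posAux T a - posAux T b = posAux T c - posAux T d := by
  rw [sub_eq_sub_iff_add_eq_add] at h ⊢
  rw [← posAux_add hT ha hd, ← posAux_add hT hc hb, h]

/-- The positive part of an order bounded operator. -/
noncomputable def posMap (T : E →ₗ[ℝ] E) (hT : IsOrderBoundedMap T) : E →ₗ[ℝ] E where
  toFun x := posAux T x⁺ - posAux T x⁻
  map_add' x y := by
    rw [posAux_sub hT (posPart_nonneg _) (negPart_nonneg _)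
      (add_nonneg (posPart_nonneg x) (posPart_nonneg y))
      (add_nonneg (negPart_nonneg x) (negPart_nonneg y)),
      posAux_add hT (posPart_nonneg x) (posPart_nonneg y),
      posAux_add hT (negPart_nonneg x) (negPart_nonneg y)]
    · abel
    · rw [posPart_sub_negPart, add_sub_add_comm, posPart_sub_negPart, posPart_sub_negPart]
  map_smul' r x := by
    simp only [RingHom.id_apply]
    rcases lt_trichotomy r 0 with hr | rfl | hr
    · have hr' : 0 < -r := neg_pos.2 hr
      rw [posAux_sub hT (posPart_nonneg _) (negPart_nonneg _)
        (smul_nonneg hr'.le (negPart_nonneg x)) (smul_nonneg hr'.le (posPart_nonneg x)),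
        posAux_smul hT hr' (posPart_nonneg x), posAux_smul hT hr' (negPart_nonneg x)]
      · module
      · rw [posPart_sub_negPart]
        conv_lhs => rw [← posPart_sub_negPart x]
        module
    · simp
    · rw [posAux_sub hT (posPart_nonneg _) (negPart_nonneg _)
        (smul_nonneg hr.le (posPart_nonneg x)) (smul_nonneg hr.le (negPart_nonneg x)),
        posAux_smul hT hr (posPart_nonneg x), posAux_smul hT hr (negPart_nonneg x), smul_sub]
      rw [posPart_sub_negPart, ← smul_sub, posPart_sub_negPart]

theorem posMap_apply {T : E →ₗ[ℝ] E} (hT : IsOrderBoundedMap T) {x : E} (hx : 0 ≤ x) :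
    posMap T hT x = posAux T x := by
  have h0 : posAux T 0 = 0 := by simp [posAux]
  change posAux T x⁺ - posAux T x⁻ = _
  rw [posPart_of_nonneg hx, negPart_of_nonneg hx, h0, sub_zero]

theorem posMap_nonneg {T : E →ₗ[ℝ] E} (hT : IsOrderBoundedMap T) {x : E} (hx : 0 ≤ x) :
    0 ≤ posMap T hT x := by
  rw [posMap_apply hT hx]
  simpa using (isLUB_posAux hT hx).1 (mem_image_of_mem T ⟨le_rfl, hx⟩)

/-- The positive part of an orthomorphism is an orthomorphism. -/
noncomputable def pos (T : Orth E) : Orth E :=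
  ⟨posMap T.1 T.2.1, by
    constructor
    · have mono : ∀ x y : E, x ≤ y → posMap T.1 T.2.1 x ≤ posMap T.1 T.2.1 y := fun x y h => by
        have := posMap_nonneg T.2.1 (sub_nonneg.2 h)
        rwa [map_sub, sub_nonneg] at this
      exact fun a b => ⟨_, _, fun x hx => ⟨mono a x hx.1, mono x b hx.2⟩⟩
    · intro B hB
      have key : ∀ x ∈ B, 0 ≤ x → posAux T.1 x ∈ B := fun x hx h0 => by
        refine hB.2 (T.1 '' Icc 0 x) ?_ ⟨_, mem_image_of_mem T.1 ⟨le_rfl, h0⟩⟩ _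
          (isLUB_posAux T.2.1 h0)
        rintro _ ⟨y, hy, rfl⟩
        refine T.2.2 B hB y (hB.1 hx ?_)
        rw [abs_of_nonneg hy.1, abs_of_nonneg h0]
        exact hy.2
      intro x hx
      refine B.sub_mem (key _ (hB.1 hx ?_) (posPart_nonneg x))
        (key _ (hB.1 hx ?_) (negPart_nonneg x))
      · rw [abs_of_nonneg (posPart_nonneg x), ← posPart_add_negPart x]
        exact le_add_of_nonneg_right (negPart_nonneg x)
      · rw [abs_of_nonneg (negPart_nonneg x), ← posPart_add_negPart x]
        exact le_add_of_nonneg_left (posPart_nonneg x)⟩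

theorem pos_nonneg (T : Orth E) : 0 ≤ pos T := fun _ hx => posMap_nonneg T.2.1 hx

theorem le_pos (T : Orth E) : T ≤ pos T := fun x hx => by
  change T.1 x ≤ posMap T.1 T.2.1 x
  rw [posMap_apply T.2.1 hx]
  exact (isLUB_posAux T.2.1 hx).1 (mem_image_of_mem T.1 ⟨hx, le_rfl⟩)

theorem pos_le {T U : Orth E} (hU : 0 ≤ U) (h : T ≤ U) : pos T ≤ U := fun x hx => by
  change posMap T.1 T.2.1 x ≤ U.1 x
  rw [posMap_apply T.2.1 hx]
  refine (isLUB_posAux T.2.1 hx).2 ?_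
  rintro _ ⟨y, hy, rfl⟩
  refine (h y hy.1).trans ?_
  have : 0 ≤ U.1 (x - y) := hU _ (sub_nonneg.2 hy.2)
  rwa [map_sub, sub_nonneg] at this

/-- For Dedekind complete `E`, the order of `Orth(E)` is a lattice order. -/
noncomputable instance instLattice : Lattice (Orth E) where
  __ := instPartialOrder
  sup S T := S + pos (T - S)
  inf S T := S - pos (S - T)
  le_sup_left S T := le_add_of_nonneg_right (pos_nonneg _)
  le_sup_right S T := sub_le_iff_le_add'.1 (le_pos (T - S))
  sup_le S T U hS hT :=
    le_sub_iff_add_le'.1 (pos_le (sub_nonneg.2 hS) (sub_le_sub_right hT S))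
  inf_le_left S T := sub_le_self S (pos_nonneg _)
  inf_le_right S T := sub_le_comm.1 (le_pos (S - T))
  le_inf U S T hS hT :=
    le_sub_comm.1 (pos_le (sub_nonneg.2 hS) (sub_le_sub_left hT S))

end Orth

end Complete

end Orthomorphisms

/-! Existence rests on three constructions. A Hausdorff o-Lebesgue topology becomes uo-Lebesgue by
passing to its unbounded version, with neighbourhoods `{x | |x| ⊓ e ∈ U}`
(`IsOLebesgue.exists_isUoLebesgue`); conversely uo-Lebesgue implies o-Lebesgue, since order
convergence implies unbounded order convergence. From `E` to `Orth E` one takes the sets `{T | |T| x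
∈ U}`: orthomorphisms decreasing to `0` do so pointwise on the positive cone (`Orth.isGLB_apply`).
From `Orth E` back to `E` one imitates convergence in measure: band projections replace measurable
sets, and `x` is small when the projection onto the band of `(|x| - r e)⁺ ⊓ e` is small in `Orth E`.
This is o-Lebesgue because these projections have infimum `0` along families with infimum `0`
(`Orth.isGLB_bandProj_excess`).

Uniqueness combines two facts. Hausdorff o-Lebesgue topologies agree near `0` on each order interval
`[0, e]` (`IsOLebesgue.exists_nhds_Icc`), and a uo-Lebesgue topology is determined by its traces on
such intervals, because `x` is small as soon as `|x| ⊓ e` is small for a suitable `e`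
(`IsUoLebesgue.exists_inf_mem`). Both proofs work with a normal sequence `W`, whose intersection
need not be trivial even in a Hausdorff topology; the part of a positive element lying in that
intersection, a largest `q`, has to be split off. -/

set_option linter.unusedSectionVars false

open LatticeOrderedAddCommGroup (IsSolid)

/-! ### Inequalities, disjointness and infima in vector lattices. -/

section LatticeGroup

variable {V : Type u} [AddCommGroup V] [Lattice V] [IsOrderedAddMonoid V]

theorem inf_add_le_of_nonneg {a b c : V} (ha : 0 ≤ a) (hb : 0 ≤ b) (hc : 0 ≤ c) :
    (a + b) ⊓ c ≤ a ⊓ c + b ⊓ c := by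
  rw [add_inf, inf_add, inf_add]
  exact le_inf (le_inf inf_le_left (inf_le_right.trans (le_add_of_nonneg_right hb)))
    (le_inf (inf_le_right.trans (le_add_of_nonneg_left ha))
      (inf_le_right.trans (le_add_of_nonneg_right hc)))

theorem inf_add_le_inf_add {a b c : V} (hc : 0 ≤ c) :
    a ⊓ (b + c) ≤ a ⊓ b + c := by
  rw [inf_add]
  exact inf_le_inf_right _ (le_add_of_nonneg_right hc)

theorem inf_nsmul_eq_zero {a u : V} (ha : 0 ≤ a) (hu : 0 ≤ u) (h : a ⊓ u = 0) (n : ℕ) :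
    a ⊓ n • u = 0 := by
  induction n with
  | zero => simpa using ha
  | succ n ih =>
    refine le_antisymm ?_ (le_inf ha (nsmul_nonneg hu _))
    rw [succ_nsmul, inf_comm]
    refine (inf_add_le_of_nonneg (nsmul_nonneg hu n) hu ha).trans_eq ?_
    rw [inf_comm, ih, inf_comm, h, add_zero]

/-- For `t ∈ S`, write `t + a ⊓ s` as the infimum plus the supremum of its two terms. The infimum is
at most `a ⊓ t ≤ 0` and the supremum at most `s`, so `s - a ⊓ s` is still an upper bound of `S`. -/
theorem inf_eq_zero_of_isLUB {S : Set V} {a s : V} (ha : 0 ≤ a) (hs : IsLUB S s) (hs0 : 0 ≤ s)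
    (h : ∀ t ∈ S, a ⊓ t ≤ 0) : a ⊓ s = 0 := by
  refine le_antisymm ?_ (le_inf ha hs0)
  have key : s ≤ s - a ⊓ s := by
    refine hs.2 fun t ht => ?_
    rw [le_sub_iff_add_le, ← inf_add_sup]
    refine (add_le_of_nonpos_left ?_).trans (sup_le (hs.1 ht) inf_le_right)
    rw [inf_comm t, inf_assoc]
    exact (inf_le_inf_left _ inf_le_right).trans (h t ht)
  simpa using key

theorem exists_isGLB_of_exists_isLUB
    (hDC : ∀ S : Set V, S.Nonempty → BddAbove S → ∃ x, IsLUB S x)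
    {S : Set V} (hS : S.Nonempty) (hS' : BddBelow S) : ∃ x, IsGLB S x := by
  obtain ⟨x, hx⟩ := hDC (lowerBounds S) hS' hS.bddAbove_lowerBounds
  exact ⟨x, isLUB_lowerBounds.1 hx⟩

theorem isGLB_sub_of_isLUB {κ : Type*} {y : κ → V} {s : V} (h : IsLUB (range y) s) :
    IsGLB (range fun k => s - y k) 0 := by
  refine ⟨?_, fun b hb => ?_⟩
  · rintro _ ⟨k, rfl⟩
    exact sub_nonneg.2 (h.1 (mem_range_self k))
  · have : s ≤ s - b := h.2 <| by
      rintro _ ⟨k, rfl⟩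
      exact le_sub_comm.1 (hb (mem_range_self k))
    simpa using this

theorem isGLB_sub_of_isGLB {κ : Type*} {y : κ → V} {s : V} (h : IsGLB (range y) s) :
    IsGLB (range fun k => y k - s) 0 := by
  refine ⟨?_, fun b hb => ?_⟩
  · rintro _ ⟨k, rfl⟩
    exact sub_nonneg.2 (h.1 (mem_range_self k))
  · have : b + s ≤ s := h.2 <| by
      rintro _ ⟨k, rfl⟩
      exact le_sub_iff_add_le.1 (hb (mem_range_self k))
    simpa using this

theorem LatticeOrderedAddCommGroup.IsSolid.mem_of_le {s : Set V}
    (hs : LatticeOrderedAddCommGroup.IsSolid s) {x y : V} (hx : x ∈ s) (hy : 0 ≤ y)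
    (hyx : y ≤ x) : y ∈ s :=
  hs hx (by rwa [abs_of_nonneg hy, abs_of_nonneg (hy.trans hyx)])

theorem LatticeOrderedAddCommGroup.IsSolid.abs_mem_iff {s : Set V}
    (hs : LatticeOrderedAddCommGroup.IsSolid s) {x : V} : |x| ∈ s ↔ x ∈ s :=
  ⟨fun h => hs h (abs_abs x).ge, fun h => hs h (abs_abs x).le⟩

variable [Module ℝ V] [IsOrderedModule ℝ V]

theorem abs_real_smul (r : ℝ) (x : V) : |r • x| = |r| • |x| := by
  have key : ∀ s : ℝ, 0 ≤ s → |s • x| = s • |x| := fun s hs => by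
    rcases hs.eq_or_lt with rfl | hs
    · simp
    · refine le_antisymm (abs_le'.2 ⟨smul_le_smul_of_nonneg_left (le_abs_self x) hs.le, ?_⟩) ?_
      · rw [← smul_neg]
        exact smul_le_smul_of_nonneg_left (neg_le_abs x) hs.le
      · rw [← le_inv_smul_iff_of_pos hs]
        refine abs_le'.2 ⟨?_, ?_⟩
        · rw [le_inv_smul_iff_of_pos hs]
          exact le_abs_self _
        · rw [le_inv_smul_iff_of_pos hs, smul_neg]
          exact neg_le_abs _
  rcases le_total 0 r with hr | hr
  · rw [key r hr, abs_of_nonneg hr]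
  · rw [abs_of_nonpos hr, ← key _ (neg_nonneg.2 hr), neg_smul, abs_neg]

/-- The Archimedean property: if all multiples `(n + 1) • b` are bounded by `x`, their supremum `s`
satisfies `s ≤ s - b`, because shifting `n` only discards a term. -/
theorem isGLB_inv_smul (hDC : ∀ S : Set V, S.Nonempty → BddAbove S → ∃ x, IsLUB S x)
    {x : V} (hx : 0 ≤ x) : IsGLB (range fun n : ℕ => ((n : ℝ) + 1)⁻¹ • x) 0 := by
  have hpos : ∀ n : ℕ, (0 : ℝ) < n + 1 := fun n => by positivity
  refine ⟨?_, fun b hb => ?_⟩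
  · rintro _ ⟨n, rfl⟩
    exact smul_nonneg (inv_nonneg.2 (hpos n).le) hx
  have hb' : ∀ n : ℕ, ((n : ℝ) + 1) • b ≤ x := fun n =>
    (le_inv_smul_iff_of_pos (hpos n)).1 (hb (mem_range_self n))
  obtain ⟨s, hs⟩ := hDC (range fun n : ℕ => ((n : ℝ) + 1) • b) (range_nonempty _)
    ⟨x, by rintro _ ⟨n, rfl⟩; exact hb' n⟩
  have : s ≤ s - b := hs.2 <| by
    rintro _ ⟨n, rfl⟩
    rw [le_sub_iff_add_le]
    have := hs.1 (mem_range_self (n + 1))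
    simp only [Nat.cast_add, Nat.cast_one] at this
    rwa [add_smul _ 1, one_smul] at this
  simpa using this

end LatticeGroup

/-! ### Locally solid topologies and the passage from o-Lebesgue to uo-Lebesgue. -/

section LocallySolid

variable {V : Type u} [AddCommGroup V] [Lattice V] [IsOrderedAddMonoid V]
  [Module ℝ V] [IsOrderedModule ℝ V]

/-- A directed family of solid, absorbing sets that is stable under halving is a base of
neighbourhoods of `0` for a locally solid linear topology. -/
theorem exists_isLocallySolidLinear {ι : Type*} [Nonempty ι] (B : ι → Set V)
    (solid : ∀ i, IsSolid (B i)) (directed : ∀ i j, ∃ k, B k ⊆ B i ∩ B j)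
    (add : ∀ i, ∃ j, ∀ x ∈ B j, ∀ y ∈ B j, x + y ∈ B i)
    (absorb : ∀ i x, ∃ r : ℝ, 0 < r ∧ r • x ∈ B i) :
    ∃ τ : TopologicalSpace V, IsLocallySolidLinear τ ∧
      (@nhds V τ 0).HasBasis (fun _ => True) B := by
  have smul_mem : ∀ i x (r : ℝ), |r| ≤ 1 → x ∈ B i → r • x ∈ B i := fun i x r hr hx => by
    refine solid i hx ?_
    rw [abs_real_smul]
    simpa using smul_le_smul_of_nonneg_right hr (abs_nonneg x)
  have zero_mem : ∀ i, (0 : V) ∈ B i := fun i => by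
    obtain ⟨r, -, h⟩ := absorb i 0
    simpa using h
  have pow_mem : ∀ (n : ℕ) i, ∃ j, ∀ x ∈ B j, (2 ^ n : ℝ) • x ∈ B i := fun n => by
    induction n with
    | zero => exact fun i => ⟨i, fun x hx => by simpa using hx⟩
    | succ n ih =>
      intro i
      obtain ⟨j, hj⟩ := add i
      obtain ⟨k, hk⟩ := ih j
      refine ⟨k, fun x hx => ?_⟩
      have := hj _ (hk x hx) _ (hk x hx)
      rwa [← two_smul ℝ, smul_smul, ← pow_succ'] at this
  let F : ModuleFilterBasis ℝ V :=
    { sets := range B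
      nonempty := range_nonempty B
      inter_sets := by
        rintro _ _ ⟨i, rfl⟩ ⟨j, rfl⟩
        obtain ⟨k, hk⟩ := directed i j
        exact ⟨_, ⟨k, rfl⟩, hk⟩
      zero' := by
        rintro _ ⟨i, rfl⟩
        exact zero_mem i
      add' := by
        rintro _ ⟨i, rfl⟩
        obtain ⟨j, hj⟩ := add i
        refine ⟨_, ⟨j, rfl⟩, ?_⟩
        rintro _ ⟨x, hx, y, hy, rfl⟩
        exact hj x hx y hy
      neg' := by
        rintro _ ⟨i, rfl⟩
        exact ⟨_, ⟨i, rfl⟩, fun x hx => solid i hx (abs_neg x).le⟩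
      conj' := by
        rintro x _ ⟨i, rfl⟩
        exact ⟨_, ⟨i, rfl⟩, fun y hy => by simpa using hy⟩
      smul' := by
        rintro _ ⟨i, rfl⟩
        refine ⟨_, Metric.closedBall_mem_nhds (0 : ℝ) one_pos, _, ⟨i, rfl⟩, ?_⟩
        rintro _ ⟨r, hr, x, hx, rfl⟩
        exact smul_mem i x r (by simpa using hr) hx
      smul_left' := by
        rintro r _ ⟨i, rfl⟩
        obtain ⟨n, hn⟩ := pow_unbounded_of_one_lt |r| (one_lt_two (α := ℝ))
        obtain ⟨j, hj⟩ := pow_mem n i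
        refine ⟨_, ⟨j, rfl⟩, fun x hx => solid i (hj x hx) ?_⟩
        rw [abs_real_smul, abs_real_smul]
        exact smul_le_smul_of_nonneg_right (hn.le.trans (le_abs_self _)) (abs_nonneg x)
      smul_right' := by
        rintro x _ ⟨i, rfl⟩
        obtain ⟨r, hr, h⟩ := absorb i x
        filter_upwards [Metric.closedBall_mem_nhds (0 : ℝ) hr] with s hs
        refine solid i h ?_
        rw [abs_real_smul, abs_real_smul]
        refine smul_le_smul_of_nonneg_right (le_trans ?_ (le_abs_self r)) (abs_nonneg x)
        simpa using hs }
  have hbasis : (@nhds V F.topology 0).HasBasis (fun _ => True) B :=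
    ⟨fun t => by
      rw [(F.toAddGroupFilterBasis.nhds_zero_hasBasis).mem_iff]
      constructor
      · rintro ⟨_, ⟨i, rfl⟩, h⟩
        exact ⟨i, trivial, h⟩
      · rintro ⟨i, -, h⟩
        exact ⟨_, ⟨i, rfl⟩, h⟩⟩
  refine ⟨F.topology, ⟨F.toAddGroupFilterBasis.isTopologicalAddGroup, F.continuousSMul,
    hbasis.to_hasBasis (fun i _ => ⟨B i, ⟨hbasis.mem_of_mem trivial, solid i⟩, subset_rfl⟩) ?_⟩,
    hbasis⟩
  rintro s ⟨hs, -⟩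
  obtain ⟨i, -, hi⟩ := hbasis.mem_iff.1 hs
  exact ⟨i, trivial, hi⟩

namespace IsLocallySolidLinear

variable {τ : TopologicalSpace V}

theorem exists_solid (h : IsLocallySolidLinear τ) {U : Set V} (hU : U ∈ @nhds V τ 0) :
    ∃ W ∈ @nhds V τ 0, IsSolid W ∧ W ⊆ U := by
  obtain ⟨W, ⟨hW, hs⟩, hWU⟩ := h.hasBasis_solid.mem_iff.1 hU
  exact ⟨W, hW, hs, hWU⟩

theorem exists_solid_add (h : IsLocallySolidLinear τ) {U : Set V} (hU : U ∈ @nhds V τ 0) :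
    ∃ W ∈ @nhds V τ 0, IsSolid W ∧ ∀ x ∈ W, ∀ y ∈ W, x + y ∈ U := by
  have := h.isTopologicalAddGroup
  obtain ⟨S, hS, hSU⟩ := exists_nhds_zero_half hU
  obtain ⟨W, hW, hs, hWS⟩ := h.exists_solid hS
  exact ⟨W, hW, hs, fun x hx y hy => hSU x (hWS hx) y (hWS hy)⟩

theorem exists_smul_mem (h : IsLocallySolidLinear τ) {U : Set V} (hU : U ∈ @nhds V τ 0) (x : V) :
    ∃ r : ℝ, 0 < r ∧ r • x ∈ U := by
  have := h.continuousSMul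
  have hc : Tendsto (fun r : ℝ => r • x) (𝓝[>] 0) (𝓝 0) := by
    have : Continuous fun r : ℝ => r • x := by fun_prop
    simpa using (this.tendsto 0).mono_left nhdsWithin_le_nhds
  obtain ⟨r, hr, hr0⟩ := ((hc.eventually_mem hU).and self_mem_nhdsWithin).exists
  exact ⟨r, hr0, hr⟩

theorem t2Space (h : IsLocallySolidLinear τ)
    (h0 : ∀ x : V, 0 ≤ x → (∀ U ∈ @nhds V τ 0, IsSolid U → x ∈ U) → x = 0) : T2Space V := by
  have := h.isTopologicalAddGroup
  refine IsTopologicalAddGroup.t2Space_of_zero_sep fun x hx => ?_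
  by_contra! H
  have : |x| = 0 := h0 _ (abs_nonneg x) fun U hU hs => hs.abs_mem_iff.2 (H U hU)
  exact hx (le_antisymm (this ▸ le_abs_self x) (neg_nonpos.1 (this ▸ neg_le_abs x)))

theorem eq_zero_of_mem (h : IsLocallySolidLinear τ) (hT : T2Space V) {x : V}
    (hx : ∀ U ∈ @nhds V τ 0, IsSolid U → x ∈ U) : x = 0 := by
  by_contra hne
  obtain ⟨U, hU, hs, hUx⟩ := h.exists_solid (isOpen_compl_singleton.mem_nhds (Ne.symm hne))
  exact hUx (hx U hU hs) rfl

theorem tendsto_of_forall_solid (h : IsLocallySolidLinear τ) {ι : Type*} {l : Filter ι}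
    {x : ι → V} (hx : ∀ U ∈ @nhds V τ 0, IsSolid U → ∀ᶠ i in l, x i ∈ U) :
    Tendsto x l (@nhds V τ 0) :=
  h.hasBasis_solid.tendsto_right_iff.2 fun U hU => hx U hU.1 hU.2

end IsLocallySolidLinear

theorem OrderTendsto.of_antitone {κ : Type u} [Preorder κ] [IsDirectedOrder κ] [Nonempty κ]
    {y : κ → V} (hy : Antitone y) (h : IsGLB (range y) 0) : OrderTendsto y 0 :=
  ⟨κ, inferInstance, inferInstance, inferInstance, y, hy, h, fun β => ⟨β, fun α hα => by
    rw [zero_sub, abs_neg, abs_of_nonneg (h.1 (mem_range_self α))]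
    exact hy hα⟩⟩

namespace IsOLebesgue

variable {τ : TopologicalSpace V}

theorem exists_mem_of_antitone (h : IsOLebesgue τ) {κ : Type u} [Preorder κ] [IsDirectedOrder κ]
    [Nonempty κ] {y : κ → V} (hy : Antitone y) (h0 : IsGLB (range y) 0) {U : Set V}
    (hU : U ∈ @nhds V τ 0) : ∃ k, y k ∈ U :=
  ((h.tendsto_of_orderTendsto κ y (.of_antitone hy h0)).eventually_mem hU).exists

theorem exists_mem_of_antitone_nat (h : IsOLebesgue τ) {y : ℕ → V} (hy : Antitone y)
    (h0 : IsGLB (range y) 0) {U : Set V} (hU : U ∈ @nhds V τ 0) : ∃ k, y k ∈ U := by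
  obtain ⟨k, hk⟩ := h.exists_mem_of_antitone (κ := ULift.{u} ℕ) (y := y ∘ ULift.down)
    (fun a b hab => hy hab) (by rwa [ULift.down_surjective.range_comp]) hU
  exact ⟨_, hk⟩

/-- Solidity transfers membership from a dominating net to the dominated one, so only decreasing
nets need testing, and for these a single member in `U` suffices. -/
theorem of_antitone (h : IsLocallySolidLinear τ)
    (H : ∀ (κ : Type u) [Preorder κ] [IsDirectedOrder κ] [Nonempty κ] (y : κ → V),
      Antitone y → IsGLB (range y) 0 → ∀ U ∈ @nhds V τ 0, ∃ k, y k ∈ U) : IsOLebesgue τ := by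
  refine ⟨h, fun ι _ _ _ x hx => h.tendsto_of_forall_solid fun U hU hs => ?_⟩
  obtain ⟨κ, _, _, _, y, hy, h0, hxy⟩ := hx
  obtain ⟨k, hk⟩ := H κ y hy h0 U hU
  obtain ⟨i, hi⟩ := hxy k
  filter_upwards [eventually_ge_atTop i] with α hα
  refine hs hk ?_
  have := hi α hα
  rw [zero_sub, abs_neg] at this
  exact this.trans (le_abs_self _)

end IsOLebesgue

theorem OrderTendsto.of_abs_le {ι : Type u} [Preorder ι] {x z : ι → V} (hx : OrderTendsto x 0)
    (hz : ∀ i, |z i| ≤ |x i|) : OrderTendsto z 0 := by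
  obtain ⟨κ, _, _, _, y, hy, h0, h⟩ := hx
  refine ⟨κ, inferInstance, inferInstance, inferInstance, y, hy, h0, fun β => ?_⟩
  obtain ⟨i, hi⟩ := h β
  refine ⟨i, fun α hα => le_trans ?_ (hi α hα)⟩
  simpa only [zero_sub, abs_neg] using hz α

theorem OrderTendsto.unboundedOrderTendsto {ι : Type u} [Preorder ι] {x : ι → V}
    (hx : OrderTendsto x 0) : UnboundedOrderTendsto x 0 := fun e he => hx.of_abs_le fun i => by
  rw [sub_zero, abs_of_nonneg (le_inf (abs_nonneg _) he)]
  exact inf_le_left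

theorem IsUoLebesgue.isOLebesgue {τ : TopologicalSpace V} (h : IsUoLebesgue τ) : IsOLebesgue τ :=
  ⟨h.toIsLocallySolidLinear, fun ι _ _ _ x hx =>
    h.tendsto_of_unboundedOrderTendsto ι x hx.unboundedOrderTendsto⟩

/-- The unbounded topology of a Hausdorff o-Lebesgue topology is a Hausdorff uo-Lebesgue
topology. -/
theorem IsOLebesgue.exists_isUoLebesgue {τ : TopologicalSpace V} (h : IsOLebesgue τ)
    (hT : T2Space V) : ∃ σ : TopologicalSpace V, IsUoLebesgue σ ∧ @T2Space V σ := by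
  let ι := {e : V // 0 ≤ e} × {U : Set V // U ∈ @nhds V τ 0 ∧ IsSolid U}
  have : Nonempty ι := ⟨⟨0, le_rfl⟩, ⟨univ, univ_mem, fun _ _ _ _ => trivial⟩⟩
  obtain ⟨σ, hσ, hb⟩ := exists_isLocallySolidLinear
    (fun i : ι => {x : V | |x| ⊓ i.1.1 ∈ i.2.1})
    (fun ⟨e, U⟩ x hx y hxy => U.2.2.mem_of_le hx (le_inf (abs_nonneg y) e.2)
      (inf_le_inf_right _ hxy))
    (fun ⟨e, U⟩ ⟨e', U'⟩ => by
      refine ⟨⟨⟨e + e', add_nonneg e.2 e'.2⟩, ⟨U ∩ U', inter_mem U.2.1 U'.2.1,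
        fun x hx y hxy => ⟨U.2.2 hx.1 hxy, U'.2.2 hx.2 hxy⟩⟩⟩, fun x hx => ⟨?_, ?_⟩⟩
      · exact U.2.2.mem_of_le hx.1 (le_inf (abs_nonneg x) e.2)
          (inf_le_inf_left _ (le_add_of_nonneg_right e'.2))
      · exact U'.2.2.mem_of_le hx.2 (le_inf (abs_nonneg x) e'.2)
          (inf_le_inf_left _ (le_add_of_nonneg_left e.2)))
    (fun ⟨e, U⟩ => by
      obtain ⟨W, hW, hs, hWU⟩ := h.exists_solid_add U.2.1
      refine ⟨⟨e, ⟨W, hW, hs⟩⟩, fun x hx y hy => ?_⟩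
      refine U.2.2.mem_of_le (hWU _ hx _ hy) (le_inf (abs_nonneg _) e.2) ?_
      exact (inf_le_inf_right _ (abs_add_le x y)).trans
        (inf_add_le_of_nonneg (abs_nonneg x) (abs_nonneg y) e.2))
    (fun ⟨e, U⟩ x => by
      obtain ⟨r, hr, hx⟩ := h.exists_smul_mem U.2.1 x
      exact ⟨r, hr, U.2.2.mem_of_le (U.2.2.abs_mem_iff.2 hx) (le_inf (abs_nonneg _) e.2)
        inf_le_left⟩)
  refine ⟨σ, ⟨hσ, fun κ _ _ _ x hx => hb.tendsto_right_iff.2 fun i _ => ?_⟩,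
    hσ.t2Space fun x hx0 hx => h.eq_zero_of_mem hT fun U hU hs => ?_⟩
  · have := h.tendsto_of_orderTendsto κ _ (hx i.1 i.1.2) i.2.2.1
    simpa using this
  -- Testing with `e = x` gives `|x| ⊓ x = x`, so `x` lies in every solid neighbourhood of the
  -- original topology.
  · have := hx _ (hb.mem_of_mem (i := (⟨⟨x, hx0⟩, ⟨U, hU, hs⟩⟩ : ι)) trivial) (by
      intro a ha b hab
      exact hs.mem_of_le ha (le_inf (abs_nonneg b) hx0) (inf_le_inf_right _ hab))
    simpa [abs_of_nonneg hx0] using this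

end LocallySolid

/-! ### Normal sequences, Amemiya's theorem and uniqueness. -/

section Uniqueness

variable {V : Type u} [AddCommGroup V] [Lattice V] [IsOrderedAddMonoid V]
  [Module ℝ V] [IsOrderedModule ℝ V]

/-- A normal sequence: solid neighbourhoods of `0` each of which contains the sum of the next one
with itself. -/
def IsNormalSeq (τ : TopologicalSpace V) (W : ℕ → Set V) : Prop :=
  ∀ n, W n ∈ @nhds V τ 0 ∧ IsSolid (W n) ∧ ∀ x ∈ W (n + 1), ∀ y ∈ W (n + 1), x + y ∈ W n

variable {τ : TopologicalSpace V} {W : ℕ → Set V}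

theorem IsLocallySolidLinear.exists_isNormalSeq (h : IsLocallySolidLinear τ) {U : Set V}
    (hU : U ∈ @nhds V τ 0) : ∃ W : ℕ → Set V, IsNormalSeq τ W ∧ W 0 ⊆ U := by
  choose! F hF hFs hFa using fun (U : Set V) (hU : U ∈ @nhds V τ 0) => h.exists_solid_add hU
  obtain ⟨U₀, hU₀, hs, hU₀U⟩ := h.exists_solid hU
  let W : ℕ → Set V := fun n => F^[n] U₀
  have hW : ∀ n, W (n + 1) = F (W n) := fun n => Function.iterate_succ_apply' F n U₀
  have hmem : ∀ n, W n ∈ @nhds V τ 0 ∧ IsSolid (W n) := fun n => by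
    induction n with
    | zero => exact ⟨hU₀, hs⟩
    | succ n ih => rw [hW]; exact ⟨hF _ ih.1, hFs _ ih.1⟩
  refine ⟨W, fun n => ⟨(hmem n).1, (hmem n).2, ?_⟩, hU₀U⟩
  rw [hW]
  exact hFa _ (hmem n).1

namespace IsNormalSeq

theorem solid (h : IsNormalSeq τ W) (n : ℕ) : IsSolid (W n) := (h n).2.1

theorem add_mem (h : IsNormalSeq τ W) {n : ℕ} {x y : V} (hx : x ∈ W (n + 1))
    (hy : y ∈ W (n + 1)) : x + y ∈ W n := (h n).2.2 x hx y hy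

theorem zero_mem (h : IsNormalSeq τ W) (n : ℕ) : (0 : V) ∈ W n := mem_of_mem_nhds (h n).1

theorem inter {W' : ℕ → Set V} (h : IsNormalSeq τ W) (h' : IsNormalSeq τ W') :
    IsNormalSeq τ (fun n => W n ∩ W' n) := fun n =>
  ⟨inter_mem (h n).1 (h' n).1, fun _ hx _ hxy => ⟨h.solid n hx.1 hxy, h'.solid n hx.2 hxy⟩,
    fun _ hx _ hy => ⟨h.add_mem hx.1 hy.1, h'.add_mem hx.2 hy.2⟩⟩

/-- Peel off the first summand: it lies in `W (k + 2)`, and so does the remaining sum, by induction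
at `k + 1`. -/
theorem sum_mem (h : IsNormalSeq τ W) {x : ℕ → V} (hx : ∀ n, x n ∈ W (n + 2)) (m k : ℕ) :
    ∑ i ∈ Finset.range m, x (k + i) ∈ W (k + 1) := by
  induction m generalizing k with
  | zero => simpa using h.zero_mem _
  | succ m ih =>
    rw [Finset.sum_range_succ', add_zero]
    refine h.add_mem ?_ (hx k)
    simpa only [add_assoc, add_comm 1] using ih (k + 1)

/-- The tail suprema of an order bounded sequence of elements of the members of a normal
sequence. -/
theorem exists_antitone (h : IsNormalSeq τ W) (hτ : IsOLebesgue τ)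
    (hDC : ∀ S : Set V, S.Nonempty → BddAbove S → ∃ x, IsLUB S x) {x : ℕ → V} {e : V}
    (hx0 : ∀ n, 0 ≤ x n) (hxe : ∀ n, x n ≤ e) (hx : ∀ n, x n ∈ W (n + 2)) :
    ∃ y : ℕ → V, Antitone y ∧ (∀ n, x n ≤ y n) ∧ (∀ n, y n ∈ W n) := by
  choose y hy using fun k => hDC (range fun i => x (k + i)) (range_nonempty _)
    ⟨e, by rintro _ ⟨i, rfl⟩; exact hxe _⟩
  refine ⟨y, antitone_nat_of_succ_le fun k => (hy (k + 1)).2 ?_, fun n => (hy n).1 ⟨0, rfl⟩,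
    fun k => ?_⟩
  · rintro _ ⟨i, rfl⟩
    exact (hy k).1 ⟨i + 1, by simp only [add_assoc, add_comm 1]⟩
  · have hlub : IsLUB (range (partialSups fun i => x (k + i))) (y k) := by
      rw [IsLUB, upperBounds_range_partialSups]
      exact hy k
    obtain ⟨m, hm⟩ := hτ.exists_mem_of_antitone_nat
      (y := fun m => y k - partialSups (fun i => x (k + i)) m)
      (fun a b hab => sub_le_sub_left ((partialSups fun i => x (k + i)).monotone hab) _)
      (isGLB_sub_of_isLUB hlub) (h (k + 1)).1
    -- A finite partial supremum is dominated by a sum in `W (k + 1)`, and what remains of `y k`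
    -- decreases to `0`, hence also enters `W (k + 1)`. This spends one index.
    rw [← sub_add_cancel (y k) (partialSups (fun i => x (k + i)) m)]
    refine h.add_mem hm ((h.solid (k + 1)).mem_of_le (h.sum_mem hx (m + 1) k) ?_ ?_)
    · exact (hx0 k).trans (le_partialSups_of_le (fun i => x (k + i)) (Nat.zero_le m))
    · exact partialSups_le _ _ _ fun j hj => Finset.single_le_sum (f := fun i => x (k + i))
        (fun i _ => hx0 _) (Finset.mem_range.2 (Nat.lt_succ_of_le hj))

/-- The intersection of a normal sequence meets `[0, x]` in a set with a largest element. -/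
theorem exists_isGreatest (h : IsNormalSeq τ W) (hτ : IsOLebesgue τ)
    (hDC : ∀ S : Set V, S.Nonempty → BddAbove S → ∃ x, IsLUB S x) {x : V} (hx : 0 ≤ x) :
    ∃ q, IsGreatest {w : V | 0 ≤ w ∧ w ≤ x ∧ ∀ n, w ∈ W n} q := by
  set S : Set V := {w : V | 0 ≤ w ∧ w ≤ x ∧ ∀ n, w ∈ W n}
  have h0 : (0 : V) ∈ S := ⟨le_rfl, hx, h.zero_mem⟩
  obtain ⟨q, hq⟩ := hDC S ⟨0, h0⟩ ⟨x, fun w hw => hw.2.1⟩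
  refine ⟨q, ⟨hq.1 h0, hq.2 fun w hw => hw.2.1, fun n => ?_⟩, hq.1⟩
  have : Nonempty S := ⟨⟨0, h0⟩⟩
  -- Directedness holds because `a ⊔ b ≤ a + b` for positive elements. Hence `q - w` decreases to
  -- `0` along `S`, and `q = (q - w) + w` lies in each `W n`.
  have : IsDirectedOrder S := ⟨fun a b => ⟨⟨a.1 ⊔ b.1, a.2.1.trans le_sup_left,
    sup_le a.2.2.1 b.2.2.1, fun n => (h.solid n).mem_of_le
      (h.add_mem (a.2.2.2 (n + 1)) (b.2.2.2 (n + 1))) (a.2.1.trans le_sup_left)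
      (sup_le (le_add_of_nonneg_right b.2.1) (le_add_of_nonneg_left a.2.1))⟩,
    show a.1 ≤ a.1 ⊔ b.1 from le_sup_left, show b.1 ≤ a.1 ⊔ b.1 from le_sup_right⟩⟩
  obtain ⟨w, hw⟩ := hτ.exists_mem_of_antitone (κ := S) (y := fun w => q - w.1)
    (fun a b hab => sub_le_sub_left (show a.1 ≤ b.1 from hab) _)
    (isGLB_sub_of_isLUB (by rwa [Subtype.range_coe])) (h (n + 1)).1
  rw [← sub_add_cancel q w.1]
  exact h.add_mem hw (w.2.2.2 _)

end IsNormalSeq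

/-- Amemiya's theorem: on order intervals, all Hausdorff o-Lebesgue topologies agree. -/
theorem IsOLebesgue.exists_nhds_Icc {σ : TopologicalSpace V} (hτ : IsOLebesgue τ)
    (hT : @T2Space V τ) (hσ : IsOLebesgue σ)
    (hDC : ∀ S : Set V, S.Nonempty → BddAbove S → ∃ x, IsLUB S x) {U : Set V}
    (hU : U ∈ @nhds V σ 0) {e : V} (he : 0 ≤ e) :
    ∃ W ∈ @nhds V τ 0, ∀ x ∈ W, 0 ≤ x → x ≤ e → x ∈ U := by
  obtain ⟨U₀, hU₀, hs₀, hU₀U⟩ := hσ.exists_solid hU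
  obtain ⟨U₁, hU₁, hs₁, hU₁U⟩ := hσ.exists_solid_add hU₀
  let κ := {W : ℕ → Set V // IsNormalSeq τ W}
  choose q hq using fun W : κ => W.2.exists_isGreatest hτ hDC he
  -- Refining the normal sequence decreases `q W`, and the infimum is `0` because `τ` is Hausdorff;
  -- the o-Lebesgue property of `σ` then makes some `q W` small.
  obtain ⟨W, hW⟩ : ∃ W : κ, q W ∈ U₁ := by
    have : Nonempty κ := by
      obtain ⟨W, hW, -⟩ := hτ.exists_isNormalSeq univ_mem
      exact ⟨⟨W, hW⟩⟩
    have : IsDirectedOrder κᵒᵈ := ⟨fun W W' => ⟨OrderDual.toDual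
      (⟨_, (OrderDual.ofDual W).2.inter (OrderDual.ofDual W').2⟩ : κ),
      fun n => inter_subset_left, fun n => inter_subset_right⟩⟩
    refine hσ.exists_mem_of_antitone (κ := κᵒᵈ) (y := fun W => q (OrderDual.ofDual W))
      (fun W W' hWW' => (hq _).2 ⟨(hq W').1.1, (hq W').1.2.1,
        fun n => (show W'.1 ≤ W.1 from hWW') n ((hq W').1.2.2 n)⟩)
      ⟨?_, fun b hb => ?_⟩ hU₁
    · rintro _ ⟨W, rfl⟩
      exact (hq W).1.1
    · have : b ⊔ 0 = 0 := hτ.eq_zero_of_mem hT fun U hU hs => by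
        obtain ⟨W, hW, hWU⟩ := hτ.exists_isNormalSeq hU
        refine hWU ((hW.solid 0).mem_of_le ((hq ⟨W, hW⟩).1.2.2 0) le_sup_right
          (sup_le (hb (mem_range_self _)) (hq ⟨W, hW⟩).1.1))
      exact le_sup_left.trans this.le
  -- Otherwise choose `x n ∈ [0, e] ∩ W (n + 2)` outside `U`, with tail suprema `y n ∈ W n`. The
  -- infimum `z` of `y n ⊓ e` lies in every `W n`, so `z ≤ q W` is small for `σ`, and so is `y k ⊓ e
  -- - z` for some `k`. This forces `x k ∈ U`.
  by_contra! H
  choose! x hx hx0 hxe hxU using fun n => H (W.1 (n + 2)) (W.2 (n + 2)).1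
  obtain ⟨y, hy, hxy, hyW⟩ := W.2.exists_antitone hτ hDC hx0 hxe hx
  have hy0 : ∀ n, 0 ≤ y n := fun n => (hx0 n).trans (hxy n)
  obtain ⟨z, hz⟩ := exists_isGLB_of_exists_isLUB hDC (range_nonempty fun n => y n ⊓ e)
    ⟨0, by rintro _ ⟨n, rfl⟩; exact le_inf (hy0 n) he⟩
  have hz0 : 0 ≤ z := hz.2 (by rintro _ ⟨n, rfl⟩; exact le_inf (hy0 n) he)
  have hzy : ∀ n, z ≤ y n ⊓ e := fun n => hz.1 (mem_range_self n)
  have hzq : z ≤ q W := (hq W).2 ⟨hz0, (hzy 0).trans inf_le_right, fun n =>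
    (W.2.solid n).mem_of_le (hyW n) hz0 ((hzy n).trans inf_le_left)⟩
  obtain ⟨k, hk⟩ := hσ.exists_mem_of_antitone_nat (y := fun k => y k ⊓ e - z)
    (fun a b hab => sub_le_sub_right (inf_le_inf_right _ (hy hab)) _)
    (isGLB_sub_of_isGLB hz) hU₁
  refine hxU k (hU₀U (hs₀.mem_of_le (hU₁U _ hk _ (hs₁.mem_of_le hW hz0 hzq)) (hx0 k) ?_))
  rw [sub_add_cancel]
  exact le_inf (hxy k) (hxe k)

/-- A uo-Lebesgue topology on a Dedekind complete vector lattice is unbounded. -/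
theorem IsUoLebesgue.exists_inf_mem (hτ : IsUoLebesgue τ)
    (hDC : ∀ S : Set V, S.Nonempty → BddAbove S → ∃ x, IsLUB S x) {U : Set V}
    (hU : U ∈ @nhds V τ 0) :
    ∃ e : V, 0 ≤ e ∧ ∃ W ∈ @nhds V τ 0, ∀ x, 0 ≤ x → x ⊓ e ∈ W → x ∈ U := by
  have hτo := hτ.isOLebesgue
  obtain ⟨W, hW, hWU⟩ := hτ.exists_isNormalSeq hU
  by_contra! H
  choose! F hF0 hFW hFU using fun (e : V) (he : 0 ≤ e) (n : ℕ) => H e he (W (n + 2)) (hW _).1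
  -- `s k` is the sum of the earlier choices, and the next one is chosen with `e = k • s k`. What
  -- matters below is that `k • s k` increases and that `x k ≤ (k + 1) • s (k + 1)`.
  let s : ℕ → V := fun n => Nat.rec 0 (fun k s => s + F (k • s) k) n
  have hs0 : ∀ k, 0 ≤ s k := fun k => by
    induction k with
    | zero => exact le_rfl
    | succ k ih => exact add_nonneg ih (hF0 _ (nsmul_nonneg ih k) k)
  set x : ℕ → V := fun k => F (k • s k) k
  have ht0 : ∀ k, 0 ≤ k • s k := fun k => nsmul_nonneg (hs0 k) k
  have hx0 : ∀ k, 0 ≤ x k := fun k => hF0 _ (ht0 k) k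
  have ht : Monotone fun k => k • s k := monotone_nat_of_le_succ fun k => by
    rw [succ_nsmul]
    refine (nsmul_le_nsmul_right ?_ k).trans (le_add_of_nonneg_right (hs0 (k + 1)))
    exact le_add_of_nonneg_right (hx0 k)
  have hxt : ∀ k, x k ≤ (k + 1) • s (k + 1) := fun k => by
    rw [succ_nsmul]
    refine le_trans ?_ (le_add_of_nonneg_left (nsmul_nonneg (hs0 (k + 1)) k))
    exact le_add_of_nonneg_left (hs0 k)
  -- Removing from `x k` its largest part `q k` in the intersection of all `W n` leaves a sequence
  -- that is uo-null. Adding `q k` back does not affect membership in `W 0`, which yields the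
  -- contradiction.
  choose q hq using fun k => hW.exists_isGreatest hτo hDC (hx0 k)
  have hc0 : ∀ k, 0 ≤ x k - q k := fun k => sub_nonneg.2 (hq k).1.2.1
  have hcx : ∀ k, x k - q k ≤ x k := fun k => sub_le_self _ (hq k).1.1
  have huo : UnboundedOrderTendsto (fun k : ULift.{u} ℕ => x k.down - q k.down) 0 := by
    intro z hz
    -- Since `x k ≤ (k + 1) • s (k + 1)`, only the part `z'` of `z` is visible to the sequence.
    -- Splitting `z'` at `z ⊓ k • s k` leaves a piece in `W (k + 2)` and a remainder decreasing to
    -- `0`.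
    obtain ⟨z', hz'⟩ := hDC (range fun k => z ⊓ k • s k) (range_nonempty _)
      ⟨z, by rintro _ ⟨k, rfl⟩; exact inf_le_left⟩
    have hrGLB := isGLB_sub_of_isLUB hz'
    obtain ⟨y, hy, hay, hyW⟩ := hW.exists_antitone hτo hDC (x := fun k => x k ⊓ (z ⊓ k • s k))
      (e := z) (fun k => le_inf (hx0 k) (le_inf hz (ht0 k)))
      (fun k => inf_le_right.trans inf_le_left) (fun k => (hW.solid _).mem_of_le
        (hFW (k • s k) (ht0 k) k) (le_inf (hx0 k) (le_inf hz (ht0 k)))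
        (inf_le_inf_left _ inf_le_right))
    have hbound : ∀ k, (x k - q k) ⊓ z ≤ y k + (z' - z ⊓ k • s k) := fun k => by
      have h1 : (x k - q k) ⊓ z ≤ x k ⊓ z' := by
        refine le_inf (inf_le_left.trans (hcx k)) (le_trans ?_ (hz'.1 (mem_range_self (k + 1))))
        exact le_inf inf_le_right (inf_le_left.trans ((hcx k).trans (hxt k)))
      refine h1.trans ?_
      calc x k ⊓ z' = x k ⊓ (z ⊓ k • s k + (z' - z ⊓ k • s k)) := by rw [add_sub_cancel]
        _ ≤ x k ⊓ (z ⊓ k • s k) + (z' - z ⊓ k • s k) :=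
          inf_add_le_inf_add (hrGLB.1 (mem_range_self k))
        _ ≤ _ := add_le_add_left (hay k) _
    have hranti : Antitone fun k => z' - z ⊓ k • s k := fun a b hab =>
      sub_le_sub_left (inf_le_inf_left _ (ht hab)) _
    choose d hd using fun k => hDC (range fun i => (x (k + i) - q (k + i)) ⊓ z)
      (range_nonempty _) ⟨z, by rintro _ ⟨i, rfl⟩; exact inf_le_right⟩
    have hdanti : Antitone d := antitone_nat_of_succ_le fun k => (hd (k + 1)).2 <| by
      rintro _ ⟨i, rfl⟩
      exact (hd k).1 ⟨i + 1, by simp only [add_assoc, add_comm 1]⟩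
    have hdy : ∀ k, d k ≤ y k + (z' - z ⊓ k • s k) := fun k => (hd k).2 <| by
      rintro _ ⟨i, rfl⟩
      exact (hbound _).trans (add_le_add (hy (Nat.le_add_right k i))
        (hranti (Nat.le_add_right k i)))
    have hcd : ∀ k, (x k - q k) ⊓ z ≤ d k := fun k => (hd k).1 ⟨0, rfl⟩
    have hd0 : ∀ k, 0 ≤ d k := fun k => (le_inf (hc0 k) hz).trans (hcd k)
    refine ⟨ULift.{u} ℕ, inferInstance, inferInstance, inferInstance, d ∘ ULift.down,
      fun a b hab => hdanti hab, ?_, fun k => ⟨k, fun j hj => ?_⟩⟩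
    · rw [ULift.down_surjective.range_comp]
      refine ⟨by rintro _ ⟨k, rfl⟩; exact hd0 k, fun b hb => ?_⟩
      have hb0 : 0 ≤ b ⊔ 0 := le_sup_right
      have hbd : ∀ k, b ⊔ 0 ≤ d k := fun k => sup_le (hb (mem_range_self k)) (hd0 k)
      -- For fixed `n`, evaluating the bound on `d` at `k + n` gives `b ⊔ 0 ≤ y n + r k` for all
      -- `k`, where `r k` is the remainder decreasing to `0`. Hence `b ⊔ 0 ≤ y n`.
      have hbW : ∀ n, b ⊔ 0 ∈ W n := fun n => by
        refine (hW.solid n).mem_of_le (hyW n) hb0 (sub_nonpos.1 (hrGLB.2 ?_))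
        rintro _ ⟨k, rfl⟩
        rw [sub_le_iff_le_add']
        refine (hbd (k + n)).trans ((hdy (k + n)).trans ?_)
        exact add_le_add (hy (Nat.le_add_left n k)) (hranti (Nat.le_add_right k n))
      -- Maximality of `q k`: adding `(b ⊔ 0) ⊓ (x k - q k)` to it stays below `x k` and in every `W
      -- n`. So `b ⊔ 0` is disjoint from every `x k - q k`, hence from `d 0`, which dominates it.
      have hbc : ∀ k, (b ⊔ 0) ⊓ (x k - q k) ≤ 0 := fun k => by
        have : (b ⊔ 0) ⊓ (x k - q k) + q k ≤ q k := (hq k).2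
          ⟨add_nonneg (le_inf hb0 (hc0 k)) (hq k).1.1,
            (add_le_add_left inf_le_right _).trans_eq (sub_add_cancel _ _),
            fun n => hW.add_mem ((hW.solid _).mem_of_le (hbW (n + 1)) (le_inf hb0 (hc0 k))
              inf_le_left) ((hq k).1.2.2 (n + 1))⟩
        simpa using this
      have hbd0 : (b ⊔ 0) ⊓ d 0 = 0 := inf_eq_zero_of_isLUB hb0 (hd 0) (hd0 0) <| by
        rintro _ ⟨i, rfl⟩
        exact (inf_le_inf_left _ inf_le_left).trans (hbc _)
      rw [inf_eq_left.2 (hbd 0)] at hbd0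
      exact le_sup_left.trans hbd0.le
    · have hj' : k.down ≤ j.down := hj
      simp only [zero_sub, abs_neg, sub_zero, Function.comp]
      rw [abs_of_nonneg (hc0 _), abs_of_nonneg (le_inf (hc0 _) hz)]
      exact (hcd _).trans (hdanti hj')
  obtain ⟨k, hk⟩ := ((hτ.tendsto_of_unboundedOrderTendsto _ _ huo).eventually_mem (hW 1).1).exists
  refine hFU (k.down • s k.down) (ht0 _) k.down (hWU ?_)
  have := hW.add_mem hk ((hq k.down).1.2.2 1)
  rwa [sub_add_cancel] at this

/-- Unboundedness of the target topology reduces the comparison to elements `|x| ⊓ e` of one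
interval `[0, e]`, where Amemiya's theorem applies. By symmetry the neighbourhood filters of `0`
coincide, and these determine group topologies. -/
theorem IsUoLebesgue.eq_of_t2Space
    (hDC : ∀ S : Set V, S.Nonempty → BddAbove S → ∃ x, IsLUB S x)
    {τ₁ τ₂ : TopologicalSpace V} (h₁ : IsUoLebesgue τ₁) (hT₁ : @T2Space V τ₁)
    (h₂ : IsUoLebesgue τ₂) (hT₂ : @T2Space V τ₂) : τ₁ = τ₂ := by
  have key : ∀ {τ σ : TopologicalSpace V}, IsUoLebesgue τ → @T2Space V τ → IsUoLebesgue σ →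
      @nhds V τ 0 ≤ @nhds V σ 0 := fun {τ σ} hτ hT hσ U hU => by
    obtain ⟨U₀, hU₀, hs, hU₀U⟩ := hσ.exists_solid hU
    obtain ⟨e, he, W, hW, hWU⟩ := hσ.exists_inf_mem hDC hU₀
    obtain ⟨W', hW', hW'W⟩ := hτ.isOLebesgue.exists_nhds_Icc hT hσ.isOLebesgue hDC hW he
    obtain ⟨W₀, hW₀, hs₀, hW₀W⟩ := hτ.exists_solid hW'
    refine mem_of_superset hW₀ fun x hx => hU₀U (hs.abs_mem_iff.1 (hWU _ (abs_nonneg x) ?_))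
    exact hW'W _ (hW₀W (hs₀.mem_of_le (hs₀.abs_mem_iff.2 hx) (le_inf (abs_nonneg x) he)
      inf_le_left)) (le_inf (abs_nonneg x) he) inf_le_right
  exact IsTopologicalAddGroup.ext h₁.isTopologicalAddGroup h₂.isTopologicalAddGroup
    (le_antisymm (key h₁ hT₁ h₂) (key h₂ hT₂ h₁))

end Uniqueness

/-! ### Suprema and infima in `Orth E`, and the transfer of topologies from `E`. -/

section Orthomorphisms

variable {E : Type u} [AddCommGroup E] [ConditionallyCompleteLattice E] [IsOrderedAddMonoid E]
  [Module ℝ E] [IsOrderedModule ℝ E]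

namespace Orth

theorem apply_mono {T : Orth E} (hT : 0 ≤ T) {x y : E} (h : x ≤ y) : T.1 x ≤ T.1 y := by
  have : 0 ≤ T.1 (y - x) := hT _ (sub_nonneg.2 h)
  rwa [map_sub, sub_nonneg] at this

/-- An additive and positively homogeneous map on the positive cone that lies between `0` and an
orthomorphism extends to an orthomorphism. -/
theorem exists_extension (f : E → E) (T : Orth E)
    (add : ∀ x y, 0 ≤ x → 0 ≤ y → f (x + y) = f x + f y)
    (smul : ∀ (r : ℝ) x, 0 < r → 0 ≤ x → r • f x ≤ f (r • x))
    (nonneg : ∀ x, 0 ≤ x → 0 ≤ f x) (le : ∀ x, 0 ≤ x → f x ≤ T.1 x) :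
    ∃ R : Orth E, ∀ x, 0 ≤ x → R.1 x = f x := by
  have smul' : ∀ (r : ℝ) x, 0 < r → 0 ≤ x → f (r • x) = r • f x := fun r x hr hx => by
    refine le_antisymm ?_ (smul r x hr hx)
    have := smul r⁻¹ (r • x) (inv_pos.2 hr) (smul_nonneg hr.le hx)
    rwa [inv_smul_smul₀ hr.ne', inv_smul_le_iff_of_pos hr] at this
  have sub : ∀ a b c d, 0 ≤ a → 0 ≤ b → 0 ≤ c → 0 ≤ d → a - b = c - d →
      f a - f b = f c - f d := fun a b c d ha hb hc hd h => by
    rw [sub_eq_sub_iff_add_eq_add] at h ⊢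
    rw [← add _ _ ha hd, ← add _ _ hc hb, h]
  have zero : f 0 = 0 := by simpa using add 0 0 le_rfl le_rfl
  let R : E →ₗ[ℝ] E :=
    { toFun := fun x => f x⁺ - f x⁻
      map_add' := fun x y => by
        rw [sub _ _ _ _ (posPart_nonneg _) (negPart_nonneg _)
          (add_nonneg (posPart_nonneg x) (posPart_nonneg y))
          (add_nonneg (negPart_nonneg x) (negPart_nonneg y)),
          add _ _ (posPart_nonneg x) (posPart_nonneg y),
          add _ _ (negPart_nonneg x) (negPart_nonneg y)]
        · abel
        · rw [posPart_sub_negPart, add_sub_add_comm, posPart_sub_negPart, posPart_sub_negPart]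
      map_smul' := fun r x => by
        simp only [RingHom.id_apply]
        rcases lt_trichotomy r 0 with hr | rfl | hr
        · have hr' : 0 < -r := neg_pos.2 hr
          rw [sub _ _ _ _ (posPart_nonneg _) (negPart_nonneg _)
            (smul_nonneg hr'.le (negPart_nonneg x)) (smul_nonneg hr'.le (posPart_nonneg x)),
            smul' _ _ hr' (posPart_nonneg x), smul' _ _ hr' (negPart_nonneg x)]
          · module
          · rw [posPart_sub_negPart]
            conv_lhs => rw [← posPart_sub_negPart x]
            module
        · simp
        · rw [sub _ _ _ _ (posPart_nonneg _) (negPart_nonneg _)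
            (smul_nonneg hr.le (posPart_nonneg x)) (smul_nonneg hr.le (negPart_nonneg x)),
            smul' _ _ hr (posPart_nonneg x), smul' _ _ hr (negPart_nonneg x), smul_sub]
          rw [posPart_sub_negPart, ← smul_sub, posPart_sub_negPart] }
  have hR : ∀ x, 0 ≤ x → R x = f x := fun x hx => by
    change f x⁺ - f x⁻ = _
    rw [posPart_of_nonneg hx, negPart_of_nonneg hx, zero, sub_zero]
  have mono : ∀ x y, x ≤ y → R x ≤ R y := fun x y h => by
    have := nonneg _ (sub_nonneg.2 h)
    rwa [← hR _ (sub_nonneg.2 h), map_sub, sub_nonneg] at this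
  refine ⟨⟨R, fun a b => ⟨_, _, fun x hx => ⟨mono a x hx.1, mono x b hx.2⟩⟩,
    fun B hB x hx => ?_⟩, hR⟩
  -- Band preservation is inherited from the dominating `T`, since bands are solid.
  have key : ∀ y ∈ B, 0 ≤ y → f y ∈ B := fun y hy h0 =>
    hB.1.mem_of_le (T.2.2 B hB y hy) (nonneg y h0) (le y h0)
  refine B.sub_mem (key _ (hB.1 hx ?_) (posPart_nonneg x)) (key _ (hB.1 hx ?_) (negPart_nonneg x))
  · rw [abs_of_nonneg (posPart_nonneg x), ← posPart_add_negPart x]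
    exact le_add_of_nonneg_right (negPart_nonneg x)
  · rw [abs_of_nonneg (negPart_nonneg x), ← posPart_add_negPart x]
    exact le_add_of_nonneg_left (posPart_nonneg x)

/-- Infima of downward directed families of positive orthomorphisms are pointwise on the positive
cone. -/
theorem exists_isGLB_apply {D : Set (Orth E)} (hD : D.Nonempty) (hD0 : ∀ T ∈ D, 0 ≤ T)
    (hdir : ∀ S ∈ D, ∀ T ∈ D, ∃ R ∈ D, R ≤ S ∧ R ≤ T) :
    ∃ R : Orth E, ∀ x, 0 ≤ x → IsGLB ((fun T : Orth E => T.1 x) '' D) (R.1 x) := by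
  let f : E → E := fun x => sInf ((fun T : Orth E => T.1 x) '' D)
  have hf : ∀ x, 0 ≤ x → IsGLB ((fun T : Orth E => T.1 x) '' D) (f x) := fun x hx =>
    isGLB_csInf (hD.image _) ⟨0, by rintro _ ⟨T, hT, rfl⟩; exact hD0 T hT x hx⟩
  have hle : ∀ x, 0 ≤ x → ∀ T ∈ D, f x ≤ T.1 x := fun x hx T hT =>
    (hf x hx).1 (mem_image_of_mem _ hT)
  obtain ⟨T₀, hT₀⟩ := hD
  obtain ⟨R, hR⟩ := exists_extension f T₀
    (fun x y hx hy => by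
      refine le_antisymm ?_ ((hf _ (add_nonneg hx hy)).2 ?_)
      · rw [← sub_le_iff_le_add]
        refine (hf x hx).2 ?_
        rintro _ ⟨S, hS, rfl⟩
        rw [sub_le_comm]
        refine (hf y hy).2 ?_
        rintro _ ⟨T, hT, rfl⟩
        -- Directedness is what makes the pointwise infimum additive: one `R` serves both `x` and
        -- `y`.
        obtain ⟨R, hR, hRS, hRT⟩ := hdir S hS T hT
        rw [sub_le_iff_le_add']
        refine (hle _ (add_nonneg hx hy) R hR).trans ?_
        rw [map_add]
        exact add_le_add (hRS x hx) (hRT y hy)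
      · rintro _ ⟨T, hT, rfl⟩
        simp only [map_add]
        exact add_le_add (hle x hx T hT) (hle y hy T hT))
    (fun r x hr hx => (hf _ (smul_nonneg hr.le hx)).2 <| by
      rintro _ ⟨T, hT, rfl⟩
      simp only [map_smul]
      exact smul_le_smul_of_nonneg_left (hle x hx T hT) hr.le)
    (fun x hx => (hf x hx).2 <| by rintro _ ⟨T, hT, rfl⟩; exact hD0 T hT x hx)
    (fun x hx => hle x hx T₀ hT₀)
  exact ⟨R, fun x hx => by rw [hR x hx]; exact hf x hx⟩

/-- The upper bounds of `S` are directed downward; subtracting a member of `S` makes them positive,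
so their infimum can be taken pointwise. -/
theorem exists_isLUB (S : Set (Orth E)) (hS : S.Nonempty) (hb : BddAbove S) :
    ∃ R, IsLUB S R := by
  obtain ⟨s, hs⟩ := hS
  obtain ⟨b, hb⟩ := hb
  obtain ⟨R, hR⟩ := exists_isGLB_apply (D := (fun T => T - s) '' upperBounds S)
    ⟨_, mem_image_of_mem _ hb⟩ (by rintro _ ⟨T, hT, rfl⟩; exact sub_nonneg.2 (hT hs)) (by
      rintro _ ⟨T, hT, rfl⟩ _ ⟨T', hT', rfl⟩
      exact ⟨_, mem_image_of_mem _ (fun U hU => le_inf (hT hU) (hT' hU)),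
        sub_le_sub_right inf_le_left s, sub_le_sub_right inf_le_right s⟩)
  refine ⟨R + s, fun U hU => ?_, fun T hT => ?_⟩
  · rw [← sub_le_iff_le_add]
    refine fun x hx => (hR x hx).2 ?_
    rintro _ ⟨_, ⟨T, hT, rfl⟩, rfl⟩
    exact sub_le_sub_right (hT hU) s x hx
  · rw [← le_sub_iff_add_le]
    exact fun x hx => (hR x hx).1 ⟨_, ⟨T, hT, rfl⟩, rfl⟩

theorem isGLB_apply {κ : Type*} [Preorder κ] [IsDirectedOrder κ] [Nonempty κ] {y : κ → Orth E}
    (hy : Antitone y) (h0 : IsGLB (range y) 0) {x : E} (hx : 0 ≤ x) :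
    IsGLB (range fun k => (y k).1 x) 0 := by
  obtain ⟨R, hR⟩ := exists_isGLB_apply (range_nonempty y) (fun T hT => h0.1 hT) (by
    rintro _ ⟨i, rfl⟩ _ ⟨j, rfl⟩
    obtain ⟨k, hik, hjk⟩ := exists_ge_ge i j
    exact ⟨_, ⟨k, rfl⟩, hy hik, hy hjk⟩)
  have hR0 : R ≤ 0 := h0.2 <| by
    rintro _ ⟨k, rfl⟩
    exact fun x hx => (hR x hx).1 (mem_image_of_mem _ (mem_range_self k))
  refine ⟨by rintro _ ⟨k, rfl⟩; exact h0.1 (mem_range_self k) x hx, fun b hb => ?_⟩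
  refine le_trans ((hR x hx).2 ?_) (hR0 x hx)
  rintro _ ⟨_, ⟨k, rfl⟩, rfl⟩
  exact hb (mem_range_self k)

/-- A Hausdorff o-Lebesgue topology on `E` induces one on `Orth E`: the topology of pointwise
convergence of the moduli. -/
theorem exists_isOLebesgue {τ : TopologicalSpace E} (h : IsOLebesgue τ) (hT : T2Space E) :
    ∃ σ : TopologicalSpace (Orth E), IsOLebesgue σ ∧ @T2Space (Orth E) σ := by
  let ι := {x : E // 0 ≤ x} × {U : Set E // U ∈ @nhds E τ 0 ∧ IsSolid U}
  have : Nonempty ι := ⟨⟨0, le_rfl⟩, ⟨univ, univ_mem, fun _ _ _ _ => trivial⟩⟩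
  have h0 : ∀ (T : Orth E) (x : {x : E // 0 ≤ x}), 0 ≤ |T|.1 x.1 := fun T x =>
    (abs_nonneg T : 0 ≤ |T|) _ x.2
  have solid : ∀ i : ι, IsSolid {T : Orth E | |T|.1 i.1.1 ∈ i.2.1} := fun ⟨x, U⟩ S hS T hTS =>
    U.2.2.mem_of_le hS (h0 T x) (hTS _ x.2)
  obtain ⟨σ, hσ, hb⟩ := exists_isLocallySolidLinear
    (fun i : ι => {T : Orth E | |T|.1 i.1.1 ∈ i.2.1}) solid
    (fun ⟨x, U⟩ ⟨x', U'⟩ => by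
      refine ⟨⟨⟨x + x', add_nonneg x.2 x'.2⟩, ⟨U ∩ U', inter_mem U.2.1 U'.2.1,
        fun x hx y hxy => ⟨U.2.2 hx.1 hxy, U'.2.2 hx.2 hxy⟩⟩⟩, fun T hT => ⟨?_, ?_⟩⟩
      · exact U.2.2.mem_of_le hT.1 (h0 T x)
          (apply_mono (abs_nonneg T) (le_add_of_nonneg_right x'.2))
      · exact U'.2.2.mem_of_le hT.2 (h0 T x')
          (apply_mono (abs_nonneg T) (le_add_of_nonneg_left x.2)))
    (fun ⟨x, U⟩ => by
      obtain ⟨W, hW, hs, hWU⟩ := h.exists_solid_add U.2.1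
      exact ⟨⟨x, ⟨W, hW, hs⟩⟩, fun S hS T hT => U.2.2.mem_of_le (hWU _ hS _ hT) (h0 _ x)
        (abs_add_le S T x.1 x.2)⟩)
    (fun ⟨x, U⟩ T => by
      obtain ⟨r, hr, hx⟩ := h.exists_smul_mem U.2.1 (|T|.1 x.1)
      refine ⟨r, hr, ?_⟩
      change |r • T|.1 x.1 ∈ U.1
      have e : |r • T| = |r| • |T| := abs_real_smul r T
      rw [e, abs_of_pos hr]
      exact hx)
  refine ⟨σ, .of_antitone hσ fun κ _ _ _ y hy hy0 U hU => ?_, hσ.t2Space fun T hT0 H => ?_⟩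
  · obtain ⟨⟨x, W⟩, -, hW⟩ := hb.mem_iff.1 hU
    obtain ⟨k, hk⟩ := h.exists_mem_of_antitone (fun a b hab => hy hab x.1 x.2)
      (isGLB_apply hy hy0 x.2) W.2.1
    refine ⟨k, hW ?_⟩
    change |y k|.1 x.1 ∈ W.1
    rwa [abs_of_nonneg (hy0.1 (mem_range_self k))]
  · refine le_antisymm (fun x hx => ?_) hT0
    refine (h.eq_zero_of_mem hT fun U hU hs => ?_).le
    have := H _ (hb.mem_of_mem (i := (⟨⟨x, hx⟩, ⟨U, hU, hs⟩⟩ : ι)) trivial) (solid _)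
    change |T|.1 x ∈ U at this
    rwa [abs_of_nonneg hT0] at this

/-- The band projection onto the band generated by `u`. -/
theorem exists_bandProjection {u : E} (hu : 0 ≤ u) :
    ∃ P : Orth E, ∀ x, 0 ≤ x → IsLUB (range fun n : ℕ => x ⊓ n • u) (P.1 x) := by
  let f : E → E := fun x => sSup (range fun n : ℕ => x ⊓ n • u)
  have hf : ∀ x, IsLUB (range fun n : ℕ => x ⊓ n • u) (f x) := fun x =>
    isLUB_csSup (range_nonempty _) ⟨x, by rintro _ ⟨n, rfl⟩; exact inf_le_left⟩
  have hle : ∀ x (n : ℕ), x ⊓ n • u ≤ f x := fun x n => (hf x).1 (mem_range_self n)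
  obtain ⟨P, hP⟩ := exists_extension f
    ⟨LinearMap.id, fun a b => ⟨a, b, fun x hx => hx⟩, fun _ _ _ hx => hx⟩
    (fun x y hx hy => by
      refine le_antisymm ((hf _).2 ?_) ?_
      · rintro _ ⟨n, rfl⟩
        exact (inf_add_le_of_nonneg hx hy (nsmul_nonneg hu n)).trans
          (add_le_add (hle x n) (hle y n))
      · rw [← le_sub_iff_add_le]
        refine (hf x).2 ?_
        rintro _ ⟨n, rfl⟩
        rw [le_sub_comm]
        refine (hf y).2 ?_
        rintro _ ⟨m, rfl⟩
        rw [le_sub_iff_add_le']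
        refine le_trans (le_inf (add_le_add inf_le_left inf_le_left) ?_) (hle _ (n + m))
        rw [add_nsmul]
        exact add_le_add inf_le_right inf_le_right)
    (fun r x hr hx => by
      rw [← le_inv_smul_iff_of_pos hr]
      refine (hf x).2 ?_
      rintro _ ⟨n, rfl⟩
      obtain ⟨m, hm⟩ := exists_nat_ge (r * n)
      rw [le_inv_smul_iff_of_pos hr]
      refine le_trans (le_inf (smul_le_smul_of_nonneg_left inf_le_left hr.le) ?_) (hle _ m)
      refine (smul_le_smul_of_nonneg_left inf_le_right hr.le).trans ?_
      rw [← Nat.cast_smul_eq_nsmul ℝ, ← Nat.cast_smul_eq_nsmul ℝ, smul_smul]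
      exact smul_le_smul_of_nonneg_right hm hu)
    (fun x hx => (le_inf hx (by simp)).trans (hle x 0))
    (fun x _ => (hf x).2 <| by rintro _ ⟨n, rfl⟩; exact inf_le_left)
  exact ⟨P, fun x hx => by rw [hP x hx]; exact hf x⟩

end Orth

end Orthomorphisms

/-! ### Band projections and the transfer of topologies from `Orth E`. -/

section BandProjections

variable {E : Type u} [AddCommGroup E] [ConditionallyCompleteLattice E] [IsOrderedAddMonoid E]
  [Module ℝ E] [IsOrderedModule ℝ E]

theorem sub_posPart_inf_eq_zero {y e w : E} (hw : w ≤ e) : (w - y)⁺ ⊓ (y - e)⁺ = 0 := by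
  refine le_antisymm ?_ (le_inf (posPart_nonneg _) (posPart_nonneg _))
  have h : (w - y)⁺ ≤ (y - e)⁻ := by
    rw [← posPart_neg, neg_sub]
    exact posPart_mono (sub_le_sub_right hw y)
  exact (inf_le_inf_right _ h).trans_eq (by rw [inf_comm, posPart_inf_negPart_eq_zero])

namespace Orth

/-- The band projection onto the band generated by a positive element. -/
noncomputable def bandProj (u : {u : E // 0 ≤ u}) : Orth E := (exists_bandProjection u.2).choose

theorem isLUB_bandProj (u : {u : E // 0 ≤ u}) {x : E} (hx : 0 ≤ x) :
    IsLUB (range fun n : ℕ => x ⊓ n • u.1) ((bandProj u).1 x) :=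
  (exists_bandProjection u.2).choose_spec x hx

theorem bandProj_nonneg (u : {u : E // 0 ≤ u}) : 0 ≤ bandProj u := fun x hx =>
  (le_inf hx (by simp)).trans ((isLUB_bandProj u hx).1 (mem_range_self 0))

theorem bandProj_mono {u v : {u : E // 0 ≤ u}} (h : u.1 ≤ v.1) : bandProj u ≤ bandProj v :=
  fun x hx => (isLUB_bandProj u hx).2 <| by
    rintro _ ⟨n, rfl⟩
    exact (inf_le_inf_left _ (nsmul_le_nsmul_right h n)).trans
      ((isLUB_bandProj v hx).1 (mem_range_self n))

theorem bandProj_add_le (u v : {u : E // 0 ≤ u}) :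
    bandProj ⟨u.1 + v.1, add_nonneg u.2 v.2⟩ ≤ bandProj u + bandProj v :=
  fun x hx => (isLUB_bandProj _ hx).2 <| by
    rintro _ ⟨n, rfl⟩
    simp only [nsmul_add]
    rw [inf_comm]
    refine (inf_add_le_of_nonneg (nsmul_nonneg u.2 n) (nsmul_nonneg v.2 n) hx).trans ?_
    rw [inf_comm, inf_comm (n • v.1)]
    exact add_le_add ((isLUB_bandProj u hx).1 (mem_range_self n))
      ((isLUB_bandProj v hx).1 (mem_range_self n))

theorem le_bandProj_self (u : {u : E // 0 ≤ u}) : u.1 ≤ (bandProj u).1 u.1 := by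
  simpa using (isLUB_bandProj u u.2).1 (mem_range_self 1)

theorem inf_bandProj_eq_zero {u : {u : E // 0 ≤ u}} {a x : E} (ha : 0 ≤ a) (hx : 0 ≤ x)
    (h : a ⊓ u.1 = 0) : a ⊓ (bandProj u).1 x = 0 :=
  inf_eq_zero_of_isLUB ha (isLUB_bandProj u hx) (bandProj_nonneg u x hx) <| by
    rintro _ ⟨n, rfl⟩
    exact (inf_le_inf_left _ inf_le_right).trans_eq (inf_nsmul_eq_zero ha u.2 h n)

/-- The truncation at `e` of the part of `y` above `e'`. -/
noncomputable def excess (e e' : {e : E // 0 ≤ e}) (y : E) : {u : E // 0 ≤ u} :=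
  ⟨(y - e'.1)⁺ ⊓ e.1, le_inf (posPart_nonneg _) e.2⟩

theorem excess_mono (e e' : {e : E // 0 ≤ e}) {y z : E} (h : y ≤ z) :
    (excess e e' y).1 ≤ (excess e e' z).1 :=
  inf_le_inf_right _ (posPart_mono (sub_le_sub_right h _))

/-- If `w = (T x)⁺` lies below all the projections of `x`, then `(r • (w ⊓ e) - y k)⁺` is disjoint
from the excess, hence from `w`. It is also below a multiple of `w`, so it vanishes and `r • (w ⊓ e)
≤ y k` for all `k`, giving `w ⊓ e = 0`. -/
theorem isGLB_bandProj_excess {κ : Type*} [Nonempty κ] {y : κ → E} (h0 : IsGLB (range y) 0)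
    (e : {e : E // 0 ≤ e}) {r : ℝ} (hr : 0 < r) :
    IsGLB (range fun k => bandProj (excess e ⟨r • e.1, smul_nonneg hr.le e.2⟩ (y k))) 0 := by
  refine ⟨by rintro _ ⟨k, rfl⟩; exact bandProj_nonneg _, fun T hT x hx => ?_⟩
  change T.1 x ≤ 0
  have hP : ∀ k, (T.1 x)⁺ ≤ (bandProj (excess e ⟨r • e.1, smul_nonneg hr.le e.2⟩ (y k))).1 x :=
    fun k => sup_le (hT (mem_range_self k) x hx) (bandProj_nonneg _ x hx)
  set w := (T.1 x)⁺ with hw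
  have hw0 : 0 ≤ w := posPart_nonneg _
  have hv0 : 0 ≤ w ⊓ e.1 := le_inf hw0 e.2
  have hy : ∀ k, r • (w ⊓ e.1) ≤ y k := fun k => by
    set u := excess e ⟨r • e.1, smul_nonneg hr.le e.2⟩ (y k) with hu
    set z := (r • (w ⊓ e.1) - y k)⁺ with hz
    have hz0 : 0 ≤ z := posPart_nonneg _
    have hzu : z ⊓ u.1 = 0 := le_antisymm ((inf_le_inf_left _ inf_le_left).trans_eq
      (sub_posPart_inf_eq_zero (smul_le_smul_of_nonneg_left inf_le_right hr.le)))
      (le_inf hz0 u.2)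
    have hzw : z ⊓ w = 0 := le_antisymm ((inf_le_inf_left _ (hP k)).trans_eq
      (inf_bandProj_eq_zero hz0 hx hzu)) (le_inf hz0 hw0)
    obtain ⟨n, hn⟩ := exists_nat_ge r
    have hzn : z ≤ n • w := by
      refine sup_le ((sub_le_self _ (h0.1 (mem_range_self k))).trans ?_) (nsmul_nonneg hw0 n)
      rw [← Nat.cast_smul_eq_nsmul ℝ]
      exact (smul_le_smul_of_nonneg_left inf_le_left hr.le).trans
        (smul_le_smul_of_nonneg_right hn hw0)
    have hz_zero : z = 0 := by
      rw [← inf_nsmul_eq_zero hz0 hw0 hzw n, inf_eq_left.2 hzn]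
    exact sub_nonpos.1 (posPart_eq_zero.1 hz_zero)
  have hwe : w ⊓ e.1 = 0 := by
    refine le_antisymm ?_ hv0
    have : r • (w ⊓ e.1) ≤ 0 := h0.2 (by rintro _ ⟨k, rfl⟩; exact hy k)
    simpa [hr.ne'] using (le_inv_smul_iff_of_pos hr).2 this
  obtain ⟨k⟩ := ‹Nonempty κ›
  -- Here the truncation at `e` is needed: being disjoint from `e`, `w` is disjoint from the excess
  -- and so from the projection that dominates it.
  have := inf_bandProj_eq_zero (u := excess e ⟨r • e.1, smul_nonneg hr.le e.2⟩ (y k)) hw0 hx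
    (le_antisymm ((inf_le_inf_left _ inf_le_right).trans_eq hwe)
      (le_inf hw0 (Subtype.property _)))
  rw [inf_eq_left.2 (hP k)] at this
  exact posPart_eq_zero.1 this

/-- A Hausdorff o-Lebesgue topology on `Orth E` induces one on `E`: the topology in which `x` is
small when the band projections onto the bands generated by the excess of `|x|` over multiples
of positive elements are small. -/
theorem exists_isOLebesgue_of_orth {τ : TopologicalSpace (Orth E)} (h : IsOLebesgue τ)
    (hT : T2Space (Orth E)) : ∃ σ : TopologicalSpace E, IsOLebesgue σ ∧ @T2Space E σ := by
  let ι := Finset {e : E // 0 ≤ e} × {r : ℝ // 0 < r} ×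
    {U : Set (Orth E) // U ∈ @nhds (Orth E) τ 0 ∧ IsSolid U}
  have : Nonempty ι := ⟨⟨∅, ⟨1, one_pos⟩, ⟨univ, univ_mem, fun _ _ _ _ => trivial⟩⟩⟩
  let P : {r : ℝ // 0 < r} → {e : E // 0 ≤ e} → E → Orth E := fun r e x =>
    bandProj (excess e ⟨r.1 • e.1, smul_nonneg r.2.le e.2⟩ x)
  have hP0 : ∀ r e x, 0 ≤ P r e x := fun r e x => bandProj_nonneg _
  have hPmono : ∀ r e, Monotone (P r e) := fun r e x y hxy => bandProj_mono (excess_mono e _ hxy)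
  -- Finite sets of `e` are used because the excess is not monotone in `e`, so two conditions cannot
  -- be merged by enlarging `e`.
  let B : ι → Set E := fun i => {x : E | ∀ e ∈ i.1, P i.2.1 e |x| ∈ i.2.2.1}
  have solid : ∀ i, IsSolid (B i) := fun ⟨F, r, U⟩ x hx y hxy e he =>
    U.2.2.mem_of_le (hx e he) (hP0 _ _ _) (hPmono _ _ hxy)
  have eventually_mem : ∀ (i : ι) {κ : Type u} [Preorder κ] [IsDirectedOrder κ] [Nonempty κ]
      {y : κ → E}, Antitone y → IsGLB (range y) 0 → ∃ k, y k ∈ B i := by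
    rintro ⟨F, r, U⟩ κ _ _ _ y hy hy0
    have H : ∀ e ∈ F, ∀ᶠ k in atTop, P r e (y k) ∈ U.1 := fun e _ => by
      obtain ⟨k, hk⟩ := h.exists_mem_of_antitone (fun a b hab => hPmono r e (hy hab))
        (isGLB_bandProj_excess hy0 e r.2) U.2.1
      filter_upwards [eventually_ge_atTop k] with j hj
      exact U.2.2.mem_of_le hk (hP0 _ _ _) (hPmono _ _ (hy hj))
    obtain ⟨k, hk⟩ := ((Filter.eventually_all_finset F).2 H).exists
    refine ⟨k, fun e he => ?_⟩
    rw [abs_of_nonneg (hy0.1 (mem_range_self k))]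
    exact hk e he
  obtain ⟨σ, hσ, hb⟩ := exists_isLocallySolidLinear B solid
    (fun ⟨F, r, U⟩ ⟨F', r', U'⟩ => by
      classical
      have hle : ∀ {s t : {r : ℝ // 0 < r}} (e : {e : E // 0 ≤ e}) (x : E), s.1 ≤ t.1 →
          P t e x ≤ P s e x := fun e x hst => bandProj_mono <|
        inf_le_inf_right _ (posPart_mono (sub_le_sub_left (smul_le_smul_of_nonneg_right hst e.2) _))
      refine ⟨⟨F ∪ F', ⟨min r.1 r'.1, lt_min r.2 r'.2⟩, ⟨U ∩ U', inter_mem U.2.1 U'.2.1,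
        fun x hx y hxy => ⟨U.2.2 hx.1 hxy, U'.2.2 hx.2 hxy⟩⟩⟩,
        fun x hx => ⟨fun e he => ?_, fun e he => ?_⟩⟩
      · exact U.2.2.mem_of_le (hx e (Finset.mem_union_left _ he)).1 (hP0 _ _ _)
          (hle e _ (min_le_left _ _))
      · exact U'.2.2.mem_of_le (hx e (Finset.mem_union_right _ he)).2 (hP0 _ _ _)
          (hle e _ (min_le_right _ _)))
    (fun ⟨F, r, U⟩ => by
      obtain ⟨W, hW, hs, hWU⟩ := h.exists_solid_add U.2.1
      -- Halving `r` splits the excess of `|x + y|` over `r • e` between `|x|` and `|y|`;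
      -- projections are subadditive in the generating element.
      refine ⟨⟨F, ⟨r.1 / 2, half_pos r.2⟩, ⟨W, hW, hs⟩⟩, fun x hx y hy e he => ?_⟩
      refine U.2.2.mem_of_le (hWU _ (hx e he) _ (hy e he)) (hP0 _ _ _) ?_
      refine (bandProj_mono ?_).trans (bandProj_add_le _ _)
      refine le_trans (inf_le_inf_right _ ?_)
        (inf_add_le_of_nonneg (posPart_nonneg _) (posPart_nonneg _) e.2)
      refine sup_le ?_ (add_nonneg (posPart_nonneg _) (posPart_nonneg _))
      refine le_trans ?_ (add_le_add (le_posPart _) (le_posPart _))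
      rw [sub_add_sub_comm, ← add_smul, add_halves]
      exact sub_le_sub_right (abs_add_le x y) _)
    (fun i x => by
      -- Absorption follows from the same fact as the o-Lebesgue property, applied to multiples of
      -- `|x|` that decrease to `0`.
      obtain ⟨n, hn⟩ := eventually_mem i (κ := ULift.{u} ℕ)
        (y := fun n => ((n.down : ℝ) + 1)⁻¹ • |x|)
        (fun a b hab => smul_le_smul_of_nonneg_right (by
          have : a.down ≤ b.down := hab
          gcongr) (abs_nonneg x))
        (by
          have := isGLB_inv_smul (fun S hS hb => ⟨_, isLUB_csSup hS hb⟩) (abs_nonneg x)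
          rwa [← ULift.down_surjective.{0, u}.range_comp] at this)
      have hpos : (0 : ℝ) < ((n.down : ℝ) + 1)⁻¹ := by positivity
      refine ⟨_, hpos, (solid i).abs_mem_iff.1 ?_⟩
      rwa [abs_real_smul, abs_of_pos hpos])
  refine ⟨σ, .of_antitone hσ fun κ _ _ _ y hy hy0 U hU => ?_, hσ.t2Space fun x hx0 H => ?_⟩
  · obtain ⟨i, -, hi⟩ := hb.mem_iff.1 hU
    obtain ⟨k, hk⟩ := eventually_mem i hy hy0
    exact ⟨k, hi hk⟩
  -- With `e = x` and `r = 1 / 2` the excess dominates `(1 / 2) • x`; it is bounded by its own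
  -- projection, which is zero.
  · have hPx : P ⟨1 / 2, half_pos one_pos⟩ ⟨x, hx0⟩ x = 0 :=
      h.eq_zero_of_mem hT fun U hU hs => by
        have := H _ (hb.mem_of_mem
          (i := (⟨{⟨x, hx0⟩}, ⟨1 / 2, half_pos one_pos⟩, ⟨U, hU, hs⟩⟩ : ι)) trivial) (solid _)
        simpa [abs_of_nonneg hx0] using this _ (Finset.mem_singleton_self _)
    set u := excess ⟨x, hx0⟩ ⟨(1 / 2 : ℝ) • x, smul_nonneg (half_pos one_pos).le hx0⟩ x with hu
    have hu0 : u.1 ≤ 0 := (le_bandProj_self u).trans_eq (by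
      have : bandProj u = 0 := hPx
      rw [this]; rfl)
    have hx2 : (1 / 2 : ℝ) • x ≤ u.1 := by
      have hx' : x - (1 / 2 : ℝ) • x = (1 / 2 : ℝ) • x := by module
      refine le_inf ((le_posPart _).trans_eq ?_) ?_
      · rw [hx']
      · rw [← sub_nonneg, hx']
        exact smul_nonneg (half_pos one_pos).le hx0
    have := (le_inv_smul_iff_of_pos (by norm_num : (0 : ℝ) < 1 / 2)).2 (hx2.trans hu0)
    exact le_antisymm (by simpa using this) hx0

end Orth

end BandProjections

/-- `E` is a Dedekind complete vector lattice (hence Archimedean). The first conjunct is the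
equivalence of the four existence statements; the other two say that a Hausdorff uo-Lebesgue
topology on `E`, respectively on `Orth E`, is necessarily unique. -/
theorem mainTheorem12 {E : Type u} [AddCommGroup E] [ConditionallyCompleteLattice E]
    [IsOrderedAddMonoid E] [Module ℝ E] [IsOrderedModule ℝ E] :
    List.TFAE [
      ∃ τ : TopologicalSpace E, IsOLebesgue τ ∧ @T2Space E τ,
      ∃ τ : TopologicalSpace (Orth E), IsOLebesgue τ ∧ @T2Space (Orth E) τ,
      ∃ τ : TopologicalSpace E, IsUoLebesgue τ ∧ @T2Space E τ,
      ∃ τ : TopologicalSpace (Orth E), IsUoLebesgue τ ∧ @T2Space (Orth E) τ] ∧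
    (∀ τ₁ τ₂ : TopologicalSpace E, IsUoLebesgue τ₁ → @T2Space E τ₁ →
      IsUoLebesgue τ₂ → @T2Space E τ₂ → τ₁ = τ₂) ∧
    (∀ τ₁ τ₂ : TopologicalSpace (Orth E), IsUoLebesgue τ₁ → @T2Space (Orth E) τ₁ →
      IsUoLebesgue τ₂ → @T2Space (Orth E) τ₂ → τ₁ = τ₂) := by
  refine ⟨?_, fun τ₁ τ₂ h₁ hT₁ h₂ hT₂ =>
    h₁.eq_of_t2Space (fun S hS hb => ⟨_, isLUB_csSup hS hb⟩) hT₁ h₂ hT₂,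
    fun τ₁ τ₂ h₁ hT₁ h₂ hT₂ => h₁.eq_of_t2Space Orth.exists_isLUB hT₁ h₂ hT₂⟩
  tfae_have 1 → 2 := fun ⟨_, h, hT⟩ => Orth.exists_isOLebesgue h hT
  tfae_have 2 → 1 := fun ⟨_, h, hT⟩ => Orth.exists_isOLebesgue_of_orth h hT
  tfae_have 1 → 3 := fun ⟨_, h, hT⟩ => h.exists_isUoLebesgue hT
  tfae_have 3 → 1 := fun ⟨τ, h, hT⟩ => ⟨τ, h.isOLebesgue, hT⟩
  tfae_have 2 → 4 := fun ⟨_, h, hT⟩ => h.exists_isUoLebesgue hT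
  tfae_have 4 → 2 := fun ⟨τ, h, hT⟩ => ⟨τ, h.isOLebesgue, hT⟩
  tfae_finish
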